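/- Let $\mathcal X\subset\mathbb R^d$ and $\mathcal Y\subset\mathbb R^{d'}$ be nonempty compact convex sets with $\|x\|^2\le D_{\mathcal X}$ for $x\in\mathcal X$ and $\|y\|^2\le D_{\mathcal Y}$ for $y\in\mathcal Y$, let $\mathbb P$ be a probability measure on a measurable space $\mathcal Z$, and let $f:\mathcal X\times\mathcal Y\times\mathcal Z\to\mathbb R$ be such that $F(x,y)=\mathbb E_{z\sim\mathbb P}f(x,y;z)$ exists for all $(x,y)\in\mathcal X\times\mathcal Y$. Let $\mu,\beta,L>0$ and assume, for every $z$: (i) $f(x,\cdot\,;z)$ is $\mu$-strongly concave on $\mathcal Y$ for every $x\in\mathcal X$; (ii) $f(\cdot,\cdot\,;z)$ is continuously differentiable on $\mathcal X\times\mathcal Y$ and its gradient $(\nabla_xf,\nabla_yf)$ is $\beta$-Lipschitz in $(x,y)$ (Euclidean norms); (iii) $\|\nabla_xf(x,y;z)\|\le L$ and $\|\nabla_yf(x,y;z)\|\le L$ for all $(x,y)\in\mathcal X\times\mathcal Y$. Let $\Phi(x)=\max_{y\in\mathcal Y}F(x,y)$, let $x^*\in\arg\min_{x\in\mathcal X}\Phi(x)$,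 and let $R_1$ be such that $\mathcal X\subset\{x:\|x-x^*\|\le R_1\}$. For an i.i.d. sample $S=(z_1,\dots,z_n)\sim\mathbb P^n$, $n\ge1$, put $F_S(x,y)=\frac1n\sum_{i=1}^nf(x,y;z_i)$ and let $(x_t,y_t)$ be the iterates of two-timescale gradient descent ascent: $(x_1,y_1)=(0,0)$, $$x_{t+1}=x_t-\eta_x\nabla_xF_S(x_t,y_t),\qquad y_{t+1}=y_t+\eta_y\nabla_yF_S(x_t,y_t),\qquad \eta_x=\frac1{16(\beta/\mu+1)^2\beta},\quad \eta_y=\frac1\beta .$$ As $f$ is given only on $\mathcal X\times\mathcal Y$, say that the algorithm runs for $T$ steps on $S$ if $(x_t,y_t)\in\mathcal X\times\mathcal Y$ for $t=1,\dots,T$. Gradients on $\mathcal X$ and $\mathcal Y$ are derivatives within these sets (if a set has empty interior, along its affine hull). (a) There is a constant $C>0$ depending only on $\mu,\beta,L,D_{\mathcal X},D_{\mathcal Y}$ such that, for all $n,T\ge1$ with $\sqrt2R_1n\ge1$ and every $\delta\in(0,1)$, with probability at least $1-\delta$ over $S$, if the algorithm runs for $T$ steps on $S$, then $$\frac1T\sum_{t=1}^T\|\nabla\Phi(x_t)\|^2\le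 \frac CT+C\,\frac{d+\log\frac{16\log_2(\sqrt2R_1n+1)}{\delta}}{n}\,T .$$ (b) For all $c_1,c_2>0$ there is a constant $C>0$ depending only on $\mu,\beta,L,D_{\mathcal X},D_{\mathcal Y},c_1,c_2$ such that, for $d\ge1$, $n\ge2$, every integer $T\ge1$ with $c_1\sqrt{n/d}\le T\le c_2\sqrt{n/d}$ and every $\delta\in(0,1)$, with probability at least $1-\delta$ over $S$, if the algorithm runs for $T$ steps on $S$, then $$\frac1T\sum_{t=1}^T\|\nabla\Phi(x_t)\|^2\le C\,\frac{d+\log\frac{\log n}{\delta}}{\sqrt{nd}} .$$ -/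

import Mathlib

open MeasureTheory
open scoped InnerProductSpace

noncomputable section

/-- `k`-dimensional Euclidean space. -/
abbrev Euc (k : ℕ) : Type := EuclideanSpace ℝ (Fin k)

/-- The gradient at `x` of a function `g` that is given on a convex set `s`. It is the derivative of
`g` within `s`, represented by a vector of the direction space of the affine hull of `s`. On a
convex `s` this vector does not depend on which derivative within `s` is chosen; at an interior
point of `s` it is the ordinary gradient. -/
def gradOn {k : ℕ} (s : Set (Euc k)) (g : Euc k → ℝ) (x : Euc k) : Euc k :=
  (vectorSpan ℝ s).starProjection (gradientWithin g s x)

/-- Partial gradient in `x` of a function on `X × Y`. -/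
def gradX {d d' : ℕ} (X : Set (Euc d)) (F : Euc d → Euc d' → ℝ) (x : Euc d) (y : Euc d') : Euc d :=
  gradOn X (fun x' => F x' y) x

/-- Partial gradient in `y` of a function on `X × Y`. -/
def gradY {d d' : ℕ} (Y : Set (Euc d')) (F : Euc d → Euc d' → ℝ) (x : Euc d) (y : Euc d') :
    Euc d' :=
  gradOn Y (F x) y

/-- Population objective `F(x, y) = 𝔼 f(x, y; z)`. -/
def popRisk {Z : Type*} [MeasurableSpace Z] {d d' : ℕ} (P : Measure Z)
    (f : Euc d → Euc d' → Z → ℝ) (x : Euc d) (y : Euc d') : ℝ :=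
  ∫ z, f x y z ∂P

/-- Empirical objective `F_S(x, y) = (1/n) ∑ f(x, y; z_i)`. -/
def empRisk {Z : Type*} {d d' n : ℕ} (f : Euc d → Euc d' → Z → ℝ) (S : Fin n → Z)
    (x : Euc d) (y : Euc d') : ℝ :=
  (1 / (n : ℝ)) * ∑ i, f x y (S i)

/-- Primal function `x ↦ max_{y ∈ Y} F(x, y)`. -/
def primal {d d' : ℕ} (Y : Set (Euc d')) (F : Euc d → Euc d' → ℝ) (x : Euc d) : ℝ :=
  sSup (F x '' Y)

/-- Iterates of two-timescale gradient descent ascent for the objective `F`, both updates being made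
at the current iterate and without projection. The entry with index `t` is the iterate
`(x_{t+1}, y_{t+1})`, so that index `0` is the starting point `(x_1, y_1) = (0, 0)`. -/
def gda {d d' : ℕ} (X : Set (Euc d)) (Y : Set (Euc d')) (F : Euc d → Euc d' → ℝ) (ηx ηy : ℝ) :
    ℕ → Euc d × Euc d'
  | 0 => (0, 0)
  | t + 1 =>
    let p := gda X Y F ηx ηy t
    (p.1 - ηx • gradX X F p.1 p.2, p.2 + ηy • gradY Y F p.1 p.2)

/-- Nonconvex-strongly-concave minimax problem on compact convex sets: `f(x, ·; z)` is
`μ`-strongly concave on `Y`, `f(·, ·; z)` is `β`-smooth on `X × Y`, and the sets are bounded by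
`‖x‖² ≤ DX`, `‖y‖² ≤ DY`. Continuity of the gradient follows from `differentiable` and `smooth`.
The last two fields say that the expectation that defines the population objective exists. -/
structure IsNCSC {Z : Type*} [MeasurableSpace Z] {d d' : ℕ} (P : Measure Z)
    (X : Set (Euc d)) (Y : Set (Euc d')) (f : Euc d → Euc d' → Z → ℝ) (μ β DX DY : ℝ) : Prop where
  nonempty_X : X.Nonempty
  nonempty_Y : Y.Nonempty
  compact_X : IsCompact X
  compact_Y : IsCompact Y
  convex_X : Convex ℝ X
  convex_Y : Convex ℝ Y
  bound_X : ∀ x ∈ X, ‖x‖ ^ 2 ≤ DX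
  bound_Y : ∀ y ∈ Y, ‖y‖ ^ 2 ≤ DY
  strongly_concave : ∀ z, ∀ x ∈ X, ∀ y₁ ∈ Y, ∀ y₂ ∈ Y,
    f x y₁ z - f x y₂ z ≤
      ⟪gradY Y (fun x y => f x y z) x y₂, y₁ - y₂⟫_ℝ - μ / 2 * ‖y₁ - y₂‖ ^ 2
  differentiable : ∀ z, DifferentiableOn ℝ (fun p : Euc d × Euc d' => f p.1 p.2 z) (X ×ˢ Y)
  smooth : ∀ z, ∀ x₁ ∈ X, ∀ x₂ ∈ X, ∀ y₁ ∈ Y, ∀ y₂ ∈ Y,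
    √(‖gradX X (fun x y => f x y z) x₁ y₁ - gradX X (fun x y => f x y z) x₂ y₂‖ ^ 2 +
        ‖gradY Y (fun x y => f x y z) x₁ y₁ - gradY Y (fun x y => f x y z) x₂ y₂‖ ^ 2) ≤
      β * √(‖x₁ - x₂‖ ^ 2 + ‖y₁ - y₂‖ ^ 2)
  measurable : ∀ x ∈ X, ∀ y ∈ Y, Measurable (f x y)
  integrable : ∀ x ∈ X, ∀ y ∈ Y, Integrable (f x y) P

/-- Lipschitz continuity: both partial gradients of `f(·, ·; z)` are bounded by `L` on `X × Y`. -/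
def IsLip {Z : Type*} {d d' : ℕ} (X : Set (Euc d)) (Y : Set (Euc d'))
    (f : Euc d → Euc d' → Z → ℝ) (L : ℝ) : Prop :=
  ∀ z, ∀ x ∈ X, ∀ y ∈ Y,
    ‖gradX X (fun x y => f x y z) x y‖ ≤ L ∧ ‖gradY Y (fun x y => f x y z) x y‖ ≤ L

/-- Iterates of two-timescale gradient descent ascent on the empirical objective of the sample `S`
with step sizes `ηx = 1 / (16 (β/μ + 1)² β)` and `ηy = 1 / β`. -/
def gdaSeq {Z : Type*} {d d' n : ℕ} (X : Set (Euc d)) (Y : Set (Euc d'))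
    (f : Euc d → Euc d' → Z → ℝ) (μ β : ℝ) (S : Fin n → Z) : ℕ → Euc d × Euc d' :=
  gda X Y (empRisk f S) (1 / (16 * (β / μ + 1) ^ 2 * β)) (1 / β)

/-- The first `T` iterates lie in `X × Y`, the set on which the objective and its gradients are
given: on this sample the algorithm produces `x_1, …, x_T`. -/
def GdaRuns {Z : Type*} {d d' n : ℕ} (X : Set (Euc d)) (Y : Set (Euc d'))
    (f : Euc d → Euc d' → Z → ℝ) (μ β : ℝ) (S : Fin n → Z) (T : ℕ) : Prop :=
  ∀ t < T, (gdaSeq X Y f μ β S t).1 ∈ X ∧ (gdaSeq X Y f μ β S t).2 ∈ Y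

/-- `(1/T) ∑_{t=1}^T ‖∇Φ(x_t)‖²`, with `Φ` the population primal function and `x_t` the iterates on
the sample `S`. -/
def avgSqGrad {Z : Type*} [MeasurableSpace Z] {d d' n : ℕ} (P : Measure Z)
    (X : Set (Euc d)) (Y : Set (Euc d')) (f : Euc d → Euc d' → Z → ℝ) (μ β : ℝ)
    (S : Fin n → Z) (T : ℕ) : ℝ :=
  (1 / (T : ℝ)) * ∑ t ∈ Finset.range T,
    ‖gradOn X (primal Y (popRisk P f)) (gdaSeq X Y f μ β S t).1‖ ^ 2

end

/-! The proof splits into optimization on the empirical problem and uniform convergence of the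
gradient of the primal function.

Optimization. Strong concavity makes the maximizer `y*(x)` Lipschitz with constant `κ = β/μ`, so the
primal function has gradient `∇ₓF(x, y*(x))` with a quadratic remainder
(`IsSmoothSaddle.abs_primal_sub_le`, `IsSmoothSaddle.gradOn_primal`). Ascent in `y` tracks the
moving maximizer, and for the given step sizes `Φ(x) + c‖y - y*(x)‖²` drops by at least
`(η/2)‖∇Φ(x)‖²` per step (`IsSmoothSaddle.potential_step`). Telescoping for `F_S` bounds the sum of
squared gradients of the empirical primal function by a constant independent of `T`.

Uniform convergence. By stability of maximizers, the two primal gradients at `x` differ by at most a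
constant times the deviations of `∇ₓF_S` and `∇ᵧF_S` from their means at `(x, y*(x))`, where `y*` is
the population maximizer (`IsSmoothSaddle.norm_gradOn_primal_sub_le`). That point does not depend on
the sample, so a dimension-free Hoeffding inequality applies to it, and a net of `X` alone suffices:
`d` enters the bound and `d'` does not. With `A = (d + log(4/δ))/n` and a net at scale `√A`, the
squared deviation is at most a constant times `√A`, uniformly on `X`
(`IsNCSC.measure_gradOn_primal_deviation_le`).

Together these give the bound `C/T + C√A` (`exists_avgSqGrad_le`). Since `2√A ≤ 1/T + A T`, it
implies (a), and the prescribed range of `T` turns it into (b). -/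

/-! ### Convexity of `cosh √u` and a majorant of `cosh` of a norm. -/

theorem Real.hasSum_cosh_sqrt {u : ℝ} (hu : 0 ≤ u) :
    HasSum (fun k : ℕ => u ^ k / ((2 * k).factorial : ℝ)) (Real.cosh √u) := by
  simpa only [pow_mul, Real.sq_sqrt hu] using Real.hasSum_cosh √u

/-- The power series in `u` has nonnegative coefficients, and each `u ^ k` is convex on the
half-line. -/
theorem Real.convexOn_cosh_sqrt : ConvexOn ℝ (Set.Ici 0) (fun u : ℝ => Real.cosh √u) := by
  refine ⟨convex_Ici 0, fun u hu v hv a b ha hb hab => ?_⟩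
  have hu' : 0 ≤ u := hu
  have hv' : 0 ≤ v := hv
  simp only [smul_eq_mul]
  refine hasSum_le (fun k => ?_) (Real.hasSum_cosh_sqrt (by positivity))
    (((Real.hasSum_cosh_sqrt hu').mul_left a).add ((Real.hasSum_cosh_sqrt hv').mul_left b))
  have h := (convexOn_pow (𝕜 := ℝ) k).2 hu hv ha hb hab
  simp only [smul_eq_mul] at h
  rw [← mul_div_assoc, ← mul_div_assoc, ← add_div]
  gcongr

/-- Affine majorant in `ξ` of `cosh ‖a + ξ‖` on the ball of radius `M`. -/
theorem exists_cosh_norm_add_le {H : Type*} [NormedAddCommGroup H] [InnerProductSpace ℝ H]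
    (a : H) {M : ℝ} (hM : 0 < M) :
    ∃ k : ℝ, ∀ ξ : H, ‖ξ‖ ≤ M →
      Real.cosh ‖a + ξ‖ ≤ Real.cosh ‖a‖ * Real.cosh M + k * ⟪a, ξ⟫_ℝ := by
  rcases eq_or_ne a 0 with rfl | ha
  · refine ⟨0, fun ξ hξ => ?_⟩
    simpa [Real.cosh_le_cosh, abs_of_pos hM] using hξ
  set r := ‖a‖ with hr
  have hr0 : 0 < r := norm_pos_iff.2 ha
  refine ⟨(Real.cosh (r + M) - Real.cosh (r - M)) / (2 * r * M), fun ξ hξ => ?_⟩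
  set s := ⟪a, ξ⟫_ℝ with hs
  have hsM : |s| ≤ r * M :=
    (abs_real_inner_le_norm a ξ).trans (mul_le_mul_of_nonneg_left hξ hr0.le)
  obtain ⟨h1, h2⟩ := abs_le.1 hsM
  -- The weight that places `r² + 2s + M²`, an upper bound for `‖a + ξ‖²`, between the extreme
  -- values `(r - M)²` and `(r + M)²`. Convexity of `cosh √u` then gives a bound affine in `s`.
  set θ := 1 / 2 + s / (2 * r * M) with hθ
  have hrM : 0 < 2 * r * M := by positivity
  have hθ0 : 0 ≤ θ := by
    have : -(1 / 2) ≤ s / (2 * r * M) := by rw [le_div_iff₀ hrM]; linarith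
    linarith
  have hθ1 : 0 ≤ 1 - θ := by
    have : s / (2 * r * M) ≤ 1 / 2 := by rw [div_le_iff₀ hrM]; linarith
    linarith
  have hsq : ‖a + ξ‖ ^ 2 ≤ θ * (r + M) ^ 2 + (1 - θ) * (r - M) ^ 2 := by
    have e : θ * (r + M) ^ 2 + (1 - θ) * (r - M) ^ 2 = r ^ 2 + 2 * s + M ^ 2 := by
      rw [hθ]; field_simp; ring
    rw [e, norm_add_sq_real]
    have := pow_le_pow_left₀ (norm_nonneg ξ) hξ 2
    linarith
  have hc := Real.convexOn_cosh_sqrt.2 (Set.mem_Ici.2 (sq_nonneg (r + M)))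
    (Set.mem_Ici.2 (sq_nonneg (r - M))) hθ0 hθ1 (by ring)
  simp only [smul_eq_mul, Real.sqrt_sq_eq_abs, Real.cosh_abs] at hc
  have hle : Real.cosh ‖a + ξ‖ ≤ Real.cosh √(θ * (r + M) ^ 2 + (1 - θ) * (r - M) ^ 2) := by
    rw [Real.cosh_le_cosh, abs_of_nonneg (norm_nonneg _), abs_of_nonneg (Real.sqrt_nonneg _)]
    exact Real.le_sqrt_of_sq_le hsq
  refine (hle.trans hc).trans (le_of_eq ?_)
  rw [hθ, Real.cosh_add, Real.cosh_sub]
  field_simp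
  ring

/-! ### Hoeffding inequality in a Hilbert space. -/

section Concentration

variable {Z : Type*} [MeasurableSpace Z] {P : Measure Z} [IsProbabilityMeasure P]
  {H : Type*} [NormedAddCommGroup H] [InnerProductSpace ℝ H] [CompleteSpace H]
  [MeasurableSpace H] [BorelSpace H] [SecondCountableTopology H]

/-- The linear term of the affine majorant has mean zero, so one centred summand costs a factor
`cosh M`, whatever the dimension. -/
theorem lintegral_cosh_norm_add_le {ξ : Z → H} {M : ℝ} (hM : 0 < M) (hξ : Measurable ξ)
    (hb : ∀ z, ‖ξ z‖ ≤ M) (h0 : ∫ z, ξ z ∂P = 0) (a : H) :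
    ∫⁻ z, ENNReal.ofReal (Real.cosh ‖a + ξ z‖) ∂P ≤
      ENNReal.ofReal (Real.cosh ‖a‖ * Real.cosh M) := by
  obtain ⟨k, hk⟩ := exists_cosh_norm_add_le a hM
  have hint : Integrable ξ P := Integrable.of_bound hξ.aestronglyMeasurable M (by simp [hb])
  have hint' : Integrable (fun z => Real.cosh ‖a + ξ z‖) P := by
    refine Integrable.of_bound (C := Real.cosh (‖a‖ + M)) ?_ ?_
    · exact (Real.measurable_cosh.comp (measurable_const.add hξ).norm).aestronglyMeasurable
    · refine Filter.Eventually.of_forall fun z => ?_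
      rw [Real.norm_of_nonneg (Real.cosh_pos _).le, Real.cosh_le_cosh, abs_of_nonneg (norm_nonneg _)]
      exact ((norm_add_le _ _).trans (by gcongr; exact hb z)).trans (le_abs_self _)
  rw [← ofReal_integral_eq_lintegral_ofReal hint'
    (Filter.Eventually.of_forall fun z => (Real.cosh_pos _).le)]
  refine ENNReal.ofReal_le_ofReal ?_
  calc ∫ z, Real.cosh ‖a + ξ z‖ ∂P
      ≤ ∫ z, (Real.cosh ‖a‖ * Real.cosh M + k * ⟪a, ξ z⟫_ℝ) ∂P := by
        refine integral_mono hint' ?_ fun z => hk _ (hb z)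
        exact (integrable_const _).add ((hint.const_inner a).const_mul k)
    _ = Real.cosh ‖a‖ * Real.cosh M := by
        rw [integral_add (integrable_const _) ((hint.const_inner a).const_mul k),
          integral_const_mul k, integral_inner hint, h0]
        simp

/-- Independence lets the samples be integrated out one at a time. The shift `a` is arbitrary so
that it can absorb the sample held fixed in the induction step. -/
theorem lintegral_cosh_norm_add_sum_le {ξ : Z → H} {M : ℝ} (hM : 0 < M) (hξ : Measurable ξ)
    (hb : ∀ z, ‖ξ z‖ ≤ M) (h0 : ∫ z, ξ z ∂P = 0) (n : ℕ) (a : H) :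
    ∫⁻ S, ENNReal.ofReal (Real.cosh ‖a + ∑ i, ξ (S i)‖) ∂(Measure.pi fun _ : Fin n => P) ≤
      ENNReal.ofReal (Real.cosh ‖a‖ * Real.cosh M ^ n) := by
  induction n generalizing a with
  | zero => simp
  | succ n ih =>
    have hmp := (measurePreserving_piFinSuccAbove (fun _ : Fin (n + 1) => P) 0).symm
    rw [← hmp.lintegral_comp_emb (MeasurableEquiv.measurableEmbedding _)]
    rw [lintegral_prod]
    · calc _ = ∫⁻ z, ∫⁻ S, ENNReal.ofReal (Real.cosh ‖(a + ξ z) + ∑ i, ξ (S i)‖)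
              ∂(Measure.pi fun _ : Fin n => P) ∂P := by
            simp [MeasurableEquiv.piFinSuccAbove, Fin.sum_univ_succ, add_assoc]
        _ ≤ ∫⁻ z, ENNReal.ofReal (Real.cosh ‖a + ξ z‖) * ENNReal.ofReal (Real.cosh M ^ n) ∂P := by
            refine lintegral_mono fun z => (ih (a + ξ z)).trans (le_of_eq ?_)
            rw [ENNReal.ofReal_mul (Real.cosh_pos _).le]
        _ ≤ ENNReal.ofReal (Real.cosh ‖a‖ * Real.cosh M) * ENNReal.ofReal (Real.cosh M ^ n) := by
            rw [lintegral_mul_const' _ _ ENNReal.ofReal_ne_top]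
            gcongr
            exact lintegral_cosh_norm_add_le hM hξ hb h0 a
        _ = _ := by
            rw [← ENNReal.ofReal_mul (by positivity)]
            ring_nf
    · refine Measurable.aemeasurable ?_
      refine ENNReal.measurable_ofReal.comp (Real.measurable_cosh.comp (Measurable.norm ?_))
      refine measurable_const.add (Finset.measurable_sum _ fun i _ => hξ.comp ?_)
      exact (measurable_pi_apply i).comp (MeasurableEquiv.measurable _)

/-- Dimension-free Hoeffding inequality for bounded centred vectors in a Hilbert space. -/
theorem measure_le_norm_average_le {ξ : Z → H} {M : ℝ} (hM : 0 < M) (hξ : Measurable ξ)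
    (hb : ∀ z, ‖ξ z‖ ≤ M) (h0 : ∫ z, ξ z ∂P = 0) {n : ℕ} (hn : 0 < n) {τ : ℝ} (hτ : 0 < τ) :
    (Measure.pi fun _ : Fin n => P) {S | τ ≤ ‖(1 / (n : ℝ)) • ∑ i, ξ (S i)‖} ≤
      ENNReal.ofReal (2 * Real.exp (-(n * τ ^ 2 / (2 * M ^ 2)))) := by
  -- Minimizer of the Chernoff exponent `n l² M² / 2 - l n τ`.
  set l : ℝ := τ / M ^ 2 with hl
  have hl0 : 0 < l := by positivity
  have hn' : (0 : ℝ) < n := by exact_mod_cast hn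
  have key := lintegral_cosh_norm_add_sum_le (P := P) (ξ := fun z => l • ξ z) (M := l * M)
    (by positivity) (hξ.const_smul l)
    (fun z => by rw [norm_smul, Real.norm_of_nonneg hl0.le]; gcongr; exact hb z)
    (by rw [integral_smul, h0, smul_zero]) n 0
  simp only [zero_add, norm_zero, Real.cosh_zero, one_mul, ← Finset.smul_sum, norm_smul,
    Real.norm_of_nonneg hl0.le] at key
  have hsub : {S : Fin n → Z | τ ≤ ‖(1 / (n : ℝ)) • ∑ i, ξ (S i)‖} ⊆
      {S | ENNReal.ofReal (Real.exp (l * (n * τ)) / 2) ≤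
        ENNReal.ofReal (Real.cosh (l * ‖∑ i, ξ (S i)‖))} := by
    intro S hS
    simp only [Set.mem_ofPred_eq] at hS ⊢
    refine ENNReal.ofReal_le_ofReal ?_
    rw [norm_smul, Real.norm_of_nonneg (by positivity), one_div, inv_mul_eq_div,
      le_div_iff₀ hn'] at hS
    rw [Real.cosh_eq]
    have h1 : Real.exp (l * (n * τ)) ≤ Real.exp (l * ‖∑ i, ξ (S i)‖) := by
      refine Real.exp_le_exp.2 (mul_le_mul_of_nonneg_left ?_ hl0.le)
      linarith
    have := Real.exp_pos (-(l * ‖∑ i, ξ (S i)‖))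
    linarith
  refine (measure_mono hsub).trans ?_
  have hm : AEMeasurable (fun S : Fin n → Z =>
      ENNReal.ofReal (Real.cosh (l * ‖∑ i, ξ (S i)‖))) (Measure.pi fun _ : Fin n => P) := by
    refine Measurable.aemeasurable (ENNReal.measurable_ofReal.comp (Real.measurable_cosh.comp ?_))
    refine ((Finset.measurable_sum _ fun i _ => hξ.comp (measurable_pi_apply i)).norm).const_mul l
  refine (meas_ge_le_lintegral_div hm ?_ ENNReal.ofReal_ne_top).trans ?_
  · simp [Real.exp_pos]
  refine (ENNReal.div_le_div_right key _).trans ?_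
  rw [← ENNReal.ofReal_div_of_pos (by positivity)]
  refine ENNReal.ofReal_le_ofReal ?_
  have h2 : Real.cosh (l * M) ^ n ≤ Real.exp (n * ((l * M) ^ 2 / 2)) := by
    rw [Real.exp_nat_mul]
    exact pow_le_pow_left₀ (Real.cosh_pos _).le (Real.cosh_le_exp_half_sq _) n
  calc Real.cosh (l * M) ^ n / (Real.exp (l * (n * τ)) / 2)
      ≤ Real.exp (n * ((l * M) ^ 2 / 2)) / (Real.exp (l * (n * τ)) / 2) := by gcongr
    _ = 2 * Real.exp (n * ((l * M) ^ 2 / 2) - l * (n * τ)) := by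
        rw [Real.exp_sub]; field_simp
    _ = 2 * Real.exp (-(n * τ ^ 2 / (2 * M ^ 2))) := by
        congr 2
        rw [hl]; field_simp; ring

end Concentration

/-! ### Covering numbers. -/

/-- Volume comparison: the balls of radius `ε/2` about the points are disjoint and lie in the ball
of radius `R + ε/2`. -/
theorem Finset.card_le_of_pairwise_le_norm_sub {E : Type*} [NormedAddCommGroup E]
    [NormedSpace ℝ E] [FiniteDimensional ℝ E] {R ε : ℝ} (hR : 0 ≤ R) (hε : 0 < ε) (s : Finset E)
    (hs : ∀ c ∈ s, ‖c‖ ≤ R) (h : ∀ c ∈ s, ∀ e ∈ s, c ≠ e → ε ≤ ‖c - e‖) :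
    (s.card : ℝ) ≤ (1 + 2 * R / ε) ^ Module.finrank ℝ E := by
  borelize E
  let ν : Measure E := Measure.addHaar
  have hδ : 0 < ε / 2 := by positivity
  have hρ : 0 < R + ε / 2 := by positivity
  have hD : Set.Pairwise (s : Set E) (Function.onFun Disjoint fun c => Metric.ball c (ε / 2)) := by
    intro c hc e he hce
    refine Metric.ball_disjoint_ball ?_
    rw [dist_eq_norm]
    simpa using h c hc e he hce
  have hsub : (⋃ c ∈ s, Metric.ball c (ε / 2)) ⊆ Metric.ball (0 : E) (R + ε / 2) := by
    refine Set.iUnion₂_subset fun x hx => Metric.ball_subset_ball' ?_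
    rw [dist_zero_right]
    linarith [hs x hx]
  have I : (s.card : ENNReal) * ENNReal.ofReal ((ε / 2) ^ Module.finrank ℝ E) * ν (Metric.ball 0 1)
      ≤ ENNReal.ofReal ((R + ε / 2) ^ Module.finrank ℝ E) * ν (Metric.ball 0 1) :=
    calc _ = ν (⋃ c ∈ s, Metric.ball c (ε / 2)) := by
          rw [measure_biUnion_finset hD fun c _ => measurableSet_ball]
          simp only [ν.addHaar_ball_of_pos _ hδ]
          simp only [Finset.sum_const, nsmul_eq_mul, mul_assoc]
      _ ≤ ν (Metric.ball (0 : E) (R + ε / 2)) := measure_mono hsub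
      _ = _ := by simp only [ν.addHaar_ball_of_pos _ hρ]
  have J := (ENNReal.mul_le_mul_iff_left (Metric.measure_ball_pos ν _ zero_lt_one).ne'
    measure_ball_lt_top.ne).1 I
  have K := ENNReal.toReal_le_of_le_ofReal (pow_nonneg hρ.le _) J
  rw [ENNReal.toReal_mul, ENNReal.toReal_ofReal (by positivity), ENNReal.toReal_natCast] at K
  have e : (1 + 2 * R / ε) = (R + ε / 2) / (ε / 2) := by field_simp; ring
  rwa [e, div_pow, le_div_iff₀ (by positivity)]

/-- A set of norms at most `R` has an `ε`-net of at most `(1 + 2R/ε)^dim` of its points. -/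
theorem exists_net_card_le {E : Type*} [NormedAddCommGroup E] [NormedSpace ℝ E]
    [FiniteDimensional ℝ E] {R ε : ℝ} (hR : 0 ≤ R) (hε : 0 < ε) (X : Set E)
    (hX : ∀ x ∈ X, ‖x‖ ≤ R) :
    ∃ s : Finset E, (∀ c ∈ s, c ∈ X) ∧ (s.card : ℝ) ≤ (1 + 2 * R / ε) ^ Module.finrank ℝ E ∧
      ∀ x ∈ X, ∃ c ∈ s, ‖x - c‖ ≤ ε := by
  classical
  let A : Set ℕ := {m | ∃ s : Finset E, s.card = m ∧ (∀ c ∈ s, c ∈ X) ∧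
    ∀ c ∈ s, ∀ e ∈ s, c ≠ e → ε ≤ ‖c - e‖}
  have hcard : ∀ s : Finset E, (∀ c ∈ s, c ∈ X) → (∀ c ∈ s, ∀ e ∈ s, c ≠ e → ε ≤ ‖c - e‖) →
      (s.card : ℝ) ≤ (1 + 2 * R / ε) ^ Module.finrank ℝ E := fun s hs h =>
    s.card_le_of_pairwise_le_norm_sub hR hε (fun c hc => hX c (hs c hc)) h
  have hbdd : BddAbove A := by
    refine ⟨⌊(1 + 2 * R / ε) ^ Module.finrank ℝ E⌋₊, ?_⟩
    rintro m ⟨s, rfl, hs, h⟩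
    exact Nat.le_floor (hcard s hs h)
  -- A separated subset of maximal cardinality is a net, since a point far from all of it could be
  -- added.
  obtain ⟨s, hsA, hs, h⟩ := Nat.sSup_mem (s := A) ⟨0, ∅, by simp⟩ hbdd
  refine ⟨s, hs, hcard s hs h, fun x hx => ?_⟩
  by_contra! hfar
  have hxs : x ∉ s := fun hxs => by
    have := hfar x hxs
    rw [sub_self, norm_zero] at this
    exact this.not_gt hε
  have hmem : (insert x s).card ∈ A := by
    refine ⟨insert x s, rfl, ?_, ?_⟩
    · simpa using ⟨hx, hs⟩
    · intro c hc e he hce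
      rcases Finset.mem_insert.1 hc with rfl | hc' <;> rcases Finset.mem_insert.1 he with rfl | he'
      · exact absurd rfl hce
      · exact (hfar e he').le
      · rw [norm_sub_rev]; exact (hfar c hc').le
      · exact h c hc' e he' hce
  have := le_csSup hbdd hmem
  rw [Finset.card_insert_of_notMem hxs, hsA] at this
  omega

/-! ### Gradients within convex sets. -/

/-- For each sign `σ`, the function `σ(φ t - φ' 0 · t) - K t² / 2` has nonpositive derivative. Along
a segment this becomes the quadratic bound for functions with Lipschitz gradient. -/
theorem abs_sub_sub_deriv_le {φ φ' : ℝ → ℝ} {K : ℝ}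
    (hφ : ∀ t ∈ Set.Icc (0 : ℝ) 1, HasDerivWithinAt φ (φ' t) (Set.Icc 0 1) t)
    (hK : ∀ t ∈ Set.Icc (0 : ℝ) 1, |φ' t - φ' 0| ≤ K * t) :
    |φ 1 - φ 0 - φ' 0| ≤ K / 2 := by
  have key : ∀ σ : ℝ, |σ| = 1 → σ * (φ 1 - φ 0 - φ' 0) ≤ K / 2 := by
    intro σ hσ
    set ψ : ℝ → ℝ := fun t => σ * (φ t - φ' 0 * t) - K / 2 * t ^ 2 with hψ
    have hd : ∀ t ∈ Set.Icc (0 : ℝ) 1,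
        HasDerivWithinAt ψ (σ * (φ' t - φ' 0) - K * t) (Set.Icc 0 1) t := by
      intro t ht
      have h1 := (((hφ t ht).sub ((hasDerivWithinAt_id t _).const_mul (φ' 0))).const_mul σ).sub
        (((hasDerivWithinAt_id t (Set.Icc (0 : ℝ) 1)).pow 2).const_mul (K / 2))
      refine h1.congr_deriv ?_
      simp
      ring
    have hanti : AntitoneOn ψ (Set.Icc 0 1) := by
      refine antitoneOn_of_hasDerivWithinAt_nonpos (convex_Icc 0 1)
        (fun t ht => (hd t ht).continuousWithinAt)
        (fun t ht => (hd t (interior_subset ht)).mono interior_subset) fun t ht => ?_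
      have h2 := hK t (interior_subset ht)
      have h3 : σ * (φ' t - φ' 0) ≤ |φ' t - φ' 0| := by
        calc σ * (φ' t - φ' 0) ≤ |σ * (φ' t - φ' 0)| := le_abs_self _
          _ = _ := by rw [abs_mul, hσ, one_mul]
      linarith
    have := hanti (Set.left_mem_Icc.2 zero_le_one) (Set.right_mem_Icc.2 zero_le_one) zero_le_one
    simp only [hψ] at this
    linarith
  refine abs_le.2 ⟨?_, ?_⟩
  · have := key (-1) (by simp)
    linarith
  · have := key 1 (by simp)
    linarith

section Grad

variable {k : ℕ} {s : Set (Euc k)} {g : Euc k → ℝ} {x : Euc k}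

theorem gradOn_mem : gradOn s g x ∈ vectorSpan ℝ s := Submodule.starProjection_apply_mem _ _

theorem inner_gradOn {v : Euc k} (hv : v ∈ vectorSpan ℝ s) :
    ⟪gradOn s g x, v⟫_ℝ = ⟪gradientWithin g s x, v⟫_ℝ := by
  rw [gradOn, Submodule.inner_starProjection_left_eq_right,
    Submodule.starProjection_eq_self_iff.2 hv]

theorem eq_of_inner_sub_eq_of_mem_vectorSpan {v : Euc k} (hv : v ∈ vectorSpan ℝ s) {w : Euc k}
    (hw : w ∈ vectorSpan ℝ s) (h : ∀ y ∈ s, ⟪v, y - x⟫_ℝ = ⟪w, y - x⟫_ℝ) (hx : x ∈ s) : v = w := by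
  have h0 : ∀ u ∈ vectorSpan ℝ s, ⟪v - w, u⟫_ℝ = 0 := by
    intro u hu
    rw [vectorSpan_eq_span_vsub_set_right ℝ hx] at hu
    induction hu using Submodule.span_induction with
    | mem u hu =>
      obtain ⟨y, hy, rfl⟩ := hu
      simp only [vsub_eq_sub]
      rw [inner_sub_left, h y hy, sub_self]
    | zero => simp
    | add a b _ _ ha hb => rw [inner_add_right, ha, hb, add_zero]
    | smul c a _ ha => rw [inner_smul_right, ha, mul_zero]
  exact sub_eq_zero.1 (inner_self_eq_zero.1 (h0 _ (Submodule.sub_mem _ hv hw)))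

theorem HasGradientWithinAt.hasDerivWithinAt_segment (hs : Convex ℝ s) (hx : x ∈ s) {y : Euc k}
    (hy : y ∈ s) {t : ℝ} {v : Euc k}
    (hg : HasGradientWithinAt g v s (x + t • (y - x))) :
    HasDerivWithinAt (fun t : ℝ => g (x + t • (y - x))) ⟪v, y - x⟫_ℝ (Set.Icc 0 1) t := by
  have hmaps : Set.MapsTo (fun t : ℝ => x + t • (y - x)) (Set.Icc 0 1) s :=
    fun t ht => hs.add_smul_sub_mem hx hy ht
  have h2 : HasDerivWithinAt (fun t : ℝ => x + t • (y - x)) (y - x) (Set.Icc 0 1) t := by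
    simpa using ((hasDerivWithinAt_id t _).smul_const (y - x)).const_add x
  refine (hg.hasFDerivWithinAt.comp_hasDerivWithinAt t h2 hmaps).congr_deriv ?_
  simp

theorem hasDerivWithinAt_segment (hs : Convex ℝ s) (hx : x ∈ s) {y : Euc k} (hy : y ∈ s)
    (hg : DifferentiableOn ℝ g s) {t : ℝ} (ht : t ∈ Set.Icc (0 : ℝ) 1) :
    HasDerivWithinAt (fun t : ℝ => g (x + t • (y - x)))
      ⟪gradOn s g (x + t • (y - x)), y - x⟫_ℝ (Set.Icc 0 1) t := by
  rw [inner_gradOn (v := y - x) (vsub_mem_vectorSpan ℝ hy hx)]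
  exact (hg _ (hs.add_smul_sub_mem hx hy ht)).hasGradientWithinAt.hasDerivWithinAt_segment
    hs hx hy

theorem abs_sub_sub_inner_gradOn_le (hs : Convex ℝ s) (hg : DifferentiableOn ℝ g s) {β : ℝ}
    (hL : ∀ a ∈ s, ∀ b ∈ s, ‖gradOn s g a - gradOn s g b‖ ≤ β * ‖a - b‖)
    (hx : x ∈ s) {y : Euc k} (hy : y ∈ s) :
    |g y - g x - ⟪gradOn s g x, y - x⟫_ℝ| ≤ β / 2 * ‖y - x‖ ^ 2 := by
  have h := abs_sub_sub_deriv_le (K := β * ‖y - x‖ ^ 2)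
    (fun t ht => hasDerivWithinAt_segment hs hx hy hg ht) ?_
  · simp only [one_smul, zero_smul, add_zero, add_sub_cancel] at h
    linarith
  · intro t ht
    have hmem := hs.add_smul_sub_mem hx hy ht
    simp only [zero_smul, add_zero]
    rw [← inner_sub_left]
    calc _ ≤ ‖gradOn s g (x + t • (y - x)) - gradOn s g x‖ * ‖y - x‖ := abs_real_inner_le_norm _ _
      _ ≤ β * ‖x + t • (y - x) - x‖ * ‖y - x‖ := by gcongr; exact hL _ hmem _ hx
      _ = _ := by
        rw [add_sub_cancel_left, norm_smul, Real.norm_of_nonneg ht.1]; ring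

/-- A quadratic remainder makes `v` a gradient within `s`. Any two such gradients agree on each `y -
x`, because the derivative along the segment is unique, and these differences span the direction
space. This identifies gradients of averages, expectations and primal functions from inequalities
alone, without differentiating an integral or a maximum. -/
theorem gradOn_eq_of_abs_sub_sub_inner_le (hs : Convex ℝ s) (hx : x ∈ s) {v : Euc k}
    (hv : v ∈ vectorSpan ℝ s) {K : ℝ}
    (h : ∀ y ∈ s, |g y - g x - ⟪v, y - x⟫_ℝ| ≤ K * ‖y - x‖ ^ 2) : gradOn s g x = v := by
  have hv' : HasGradientWithinAt g v s x := by
    rw [hasGradientWithinAt_iff_isLittleO]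
    refine Asymptotics.IsBigO.trans_isLittleO (g := fun y => ‖y - x‖ ^ 2) ?_ ?_
    · refine Asymptotics.IsBigO.of_bound K ?_
      filter_upwards [self_mem_nhdsWithin] with y hy
      simpa using h y hy
    · have h1 : (fun y : Euc k => y - x) =o[nhdsWithin x s] fun _ => (1 : ℝ) := by
        refine (Asymptotics.isLittleO_one_iff ℝ).2 ?_
        refine Filter.Tendsto.mono_left ?_ nhdsWithin_le_nhds
        simpa using (continuous_id.sub continuous_const).tendsto (f := fun y : Euc k => y - x) x
      have h2 := (Asymptotics.isBigO_refl (fun y : Euc k => ‖y - x‖) (nhdsWithin x s)).mul_isLittleO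
        h1.norm_left
      simp only [mul_one] at h2
      simpa [pow_two] using h2.norm_right
  have hg := hv'.differentiableWithinAt.hasGradientWithinAt
  refine eq_of_inner_sub_eq_of_mem_vectorSpan gradOn_mem hv (fun y hy => ?_) hx
  rw [inner_gradOn (v := y - x) (vsub_mem_vectorSpan ℝ hy hx)]
  have hx0 : x + (0 : ℝ) • (y - x) = x := by rw [zero_smul, add_zero]
  rw [← hx0] at hg hv'
  have h0 : (0 : ℝ) ∈ Set.Icc (0 : ℝ) 1 := Set.left_mem_Icc.2 zero_le_one
  have hu := (uniqueDiffOn_Icc (zero_lt_one (α := ℝ)) 0 h0).eq_deriv _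
    (hg.hasDerivWithinAt_segment hs hx hy) (hv'.hasDerivWithinAt_segment hs hx hy)
  rwa [hx0] at hu

end Grad

/-! ### Measurability of gradients in the sample variable. -/

section Measurability

theorem measurable_of_inner {Z : Type*} [MeasurableSpace Z] {k : ℕ} {V : Submodule ℝ (Euc k)}
    {v : Z → Euc k} (hV : ∀ z, v z ∈ V) (h : ∀ u ∈ V, Measurable fun z => ⟪v z, u⟫_ℝ) :
    Measurable v := by
  have h' : ∀ u, Measurable fun z => ⟪v z, u⟫_ℝ := by
    intro u
    have e : (fun z => ⟪v z, u⟫_ℝ) = fun z => ⟪v z, V.starProjection u⟫_ℝ := by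
      funext z
      rw [← Submodule.inner_starProjection_left_eq_right,
        Submodule.starProjection_eq_self_iff.2 (hV z)]
    rw [e]
    exact h _ (Submodule.starProjection_apply_mem _ _)
  have h2 : Measurable fun z => (v z).ofLp := by
    refine measurable_pi_lambda _ fun i => ?_
    simpa [EuclideanSpace.inner_single_right] using h' (EuclideanSpace.single i 1)
  exact (WithLp.measurable_toLp 2 _).comp h2

/-- The inner product with `y - x` is a limit of difference quotients along the segment, each
measurable in `z`; such vectors span the direction space. -/
theorem measurable_gradOn {Z : Type*} [MeasurableSpace Z] {k : ℕ} {s : Set (Euc k)}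
    (hs : Convex ℝ s) {g : Z → Euc k → ℝ} (hg : ∀ z, DifferentiableOn ℝ (g z) s)
    (hm : ∀ y ∈ s, Measurable fun z => g z y) {x : Euc k} (hx : x ∈ s) :
    Measurable fun z => gradOn s (g z) x := by
  refine measurable_of_inner (V := vectorSpan ℝ s) (fun z => gradOn_mem) fun u hu => ?_
  rw [vectorSpan_eq_span_vsub_set_right ℝ hx] at hu
  induction hu using Submodule.span_induction with
  | zero => simp
  | add a b _ _ ha hb => simp only [inner_add_right]; exact ha.add hb
  | smul c a _ ha => simpa only [inner_smul_right] using ha.const_mul c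
  | mem u hu =>
    obtain ⟨y, hy, rfl⟩ := hu
    simp only [vsub_eq_sub]
    set τ : ℕ → ℝ := fun n => 1 / ((n : ℝ) + 1) with hτ
    have hτ0 : ∀ n, 0 < τ n := fun n => by positivity
    have hτ1 : ∀ n, τ n ∈ Set.Icc (0 : ℝ) 1 := fun n =>
      ⟨(hτ0 n).le, by rw [hτ]; simp only; rw [div_le_one (by positivity)]; simp⟩
    refine measurable_of_tendsto_metrizable
      (f := fun n z => (τ n)⁻¹ * (g z (x + τ n • (y - x)) - g z x)) (fun n => ?_) ?_
    · exact ((hm _ (hs.add_smul_sub_mem hx hy (hτ1 n))).sub (hm x hx)).const_mul _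
    · rw [tendsto_pi_nhds]
      intro z
      have h1 := hasDerivWithinAt_segment hs hx hy (hg z) (t := 0) (by simp)
      have h2 := (hasDerivWithinAt_iff_tendsto_slope.1 h1)
      have h3 : Filter.Tendsto τ Filter.atTop (nhdsWithin 0 (Set.Icc 0 1 \ {0})) := by
        refine tendsto_nhdsWithin_iff.2 ⟨tendsto_one_div_add_atTop_nhds_zero_nat, ?_⟩
        exact Filter.Eventually.of_forall fun n => ⟨hτ1 n, (hτ0 n).ne'⟩
      have h4 := h2.comp h3
      simpa [Function.comp_def, slope_def_field, div_eq_inv_mul] using h4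

end Measurability

/-! ### Saddle objectives and their averages. -/

/-- `F` is a smooth, strongly concave saddle objective on `X × Y` with partial gradients `Gx` and
`Gy`; smoothness is recorded through the quadratic bounds it implies on each factor. -/
structure IsSmoothSaddle {d d' : ℕ} (X : Set (Euc d)) (Y : Set (Euc d'))
    (F : Euc d → Euc d' → ℝ) (Gx : Euc d → Euc d' → Euc d) (Gy : Euc d → Euc d' → Euc d')
    (μ β L : ℝ) : Prop where
  mem_x : ∀ x ∈ X, ∀ y ∈ Y, Gx x y ∈ vectorSpan ℝ X
  mem_y : ∀ x ∈ X, ∀ y ∈ Y, Gy x y ∈ vectorSpan ℝ Y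
  quad_x : ∀ x ∈ X, ∀ x' ∈ X, ∀ y ∈ Y,
    |F x' y - F x y - ⟪Gx x y, x' - x⟫_ℝ| ≤ β / 2 * ‖x' - x‖ ^ 2
  quad_y : ∀ x ∈ X, ∀ y ∈ Y, ∀ y' ∈ Y,
    |F x y' - F x y - ⟪Gy x y, y' - y⟫_ℝ| ≤ β / 2 * ‖y' - y‖ ^ 2
  concave : ∀ x ∈ X, ∀ y ∈ Y, ∀ y' ∈ Y,
    F x y' - F x y ≤ ⟪Gy x y, y' - y⟫_ℝ - μ / 2 * ‖y' - y‖ ^ 2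
  lip_x : ∀ x ∈ X, ∀ x' ∈ X, ∀ y ∈ Y, ∀ y' ∈ Y,
    ‖Gx x y - Gx x' y'‖ ≤ β * (‖x - x'‖ + ‖y - y'‖)
  lip_y : ∀ x ∈ X, ∀ x' ∈ X, ∀ y ∈ Y, ∀ y' ∈ Y,
    ‖Gy x y - Gy x' y'‖ ≤ β * (‖x - x'‖ + ‖y - y'‖)
  bound_x : ∀ x ∈ X, ∀ y ∈ Y, ‖Gx x y‖ ≤ L
  bound_y : ∀ x ∈ X, ∀ y ∈ Y, ‖Gy x y‖ ≤ L

section Construction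

variable {d d' : ℕ} {X : Set (Euc d)} {Y : Set (Euc d')} {Z : Type*} [MeasurableSpace Z]
  {P : Measure Z} {f : Euc d → Euc d' → Z → ℝ} {μ β L DX DY : ℝ}

theorem IsNCSC.differentiableOn_left (h : IsNCSC P X Y f μ β DX DY) (z : Z) {y : Euc d'}
    (hy : y ∈ Y) : DifferentiableOn ℝ (fun x => f x y z) X := by
  have h1 : DifferentiableOn ℝ (fun x : Euc d => (x, y)) X :=
    (differentiable_id.prodMk (differentiable_const y)).differentiableOn
  exact (h.differentiable z).comp h1 fun x hx => ⟨hx, hy⟩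

theorem IsNCSC.differentiableOn_right (h : IsNCSC P X Y f μ β DX DY) (z : Z) {x : Euc d}
    (hx : x ∈ X) : DifferentiableOn ℝ (fun y => f x y z) Y := by
  have h1 : DifferentiableOn ℝ (fun y : Euc d' => (x, y)) Y :=
    ((differentiable_const x).prodMk differentiable_id).differentiableOn
  exact (h.differentiable z).comp h1 fun y hy => ⟨hx, hy⟩

theorem Real.sqrt_sq_add_sq_le_add {a b : ℝ} (ha : 0 ≤ a) (hb : 0 ≤ b) :
    √(a ^ 2 + b ^ 2) ≤ a + b :=
  Real.sqrt_le_iff.2 ⟨by positivity, by nlinarith [mul_nonneg ha hb]⟩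

theorem IsNCSC.isSmoothSaddle (h : IsNCSC P X Y f μ β DX DY) (hL : IsLip X Y f L) (hβ : 0 ≤ β)
    (z : Z) : IsSmoothSaddle X Y (fun x y => f x y z) (gradX X fun x y => f x y z)
      (gradY Y fun x y => f x y z) μ β L := by
  have hx : ∀ x ∈ X, ∀ x' ∈ X, ∀ y ∈ Y, ∀ y' ∈ Y,
      ‖gradX X (fun x y => f x y z) x y - gradX X (fun x y => f x y z) x' y'‖ ≤
        β * (‖x - x'‖ + ‖y - y'‖) := by
    intro x hx x' hx' y hy y' hy'
    calc _ ≤ √(‖gradX X (fun x y => f x y z) x y - gradX X (fun x y => f x y z) x' y'‖ ^ 2 +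
          ‖gradY Y (fun x y => f x y z) x y - gradY Y (fun x y => f x y z) x' y'‖ ^ 2) :=
          Real.le_sqrt_of_sq_le (le_add_of_nonneg_right (sq_nonneg _))
      _ ≤ β * √(‖x - x'‖ ^ 2 + ‖y - y'‖ ^ 2) := h.smooth z x hx x' hx' y hy y' hy'
      _ ≤ _ := by gcongr; exact Real.sqrt_sq_add_sq_le_add (norm_nonneg _) (norm_nonneg _)
  have hy : ∀ x ∈ X, ∀ x' ∈ X, ∀ y ∈ Y, ∀ y' ∈ Y,
      ‖gradY Y (fun x y => f x y z) x y - gradY Y (fun x y => f x y z) x' y'‖ ≤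
        β * (‖x - x'‖ + ‖y - y'‖) := by
    intro x hx x' hx' y hy y' hy'
    calc _ ≤ √(‖gradX X (fun x y => f x y z) x y - gradX X (fun x y => f x y z) x' y'‖ ^ 2 +
          ‖gradY Y (fun x y => f x y z) x y - gradY Y (fun x y => f x y z) x' y'‖ ^ 2) :=
          Real.le_sqrt_of_sq_le (le_add_of_nonneg_left (sq_nonneg _))
      _ ≤ β * √(‖x - x'‖ ^ 2 + ‖y - y'‖ ^ 2) := h.smooth z x hx x' hx' y hy y' hy'
      _ ≤ _ := by gcongr; exact Real.sqrt_sq_add_sq_le_add (norm_nonneg _) (norm_nonneg _)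
  exact
    { mem_x := fun x _ y _ => gradOn_mem
      mem_y := fun x _ y _ => gradOn_mem
      quad_x := fun x hx0 x' hx' y hy0 =>
        abs_sub_sub_inner_gradOn_le h.convex_X (h.differentiableOn_left z hy0)
          (fun a ha b hb => by simpa [gradX] using hx a ha b hb y hy0 y hy0) hx0 hx'
      quad_y := fun x hx0 y hy0 y' hy' =>
        abs_sub_sub_inner_gradOn_le h.convex_Y (h.differentiableOn_right z hx0)
          (fun a ha b hb => by simpa [gradY] using hy x hx0 x hx0 a ha b hb) hy0 hy'
      concave := fun x hx0 y hy0 y' hy' => h.strongly_concave z x hx0 y' hy' y hy0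
      lip_x := hx
      lip_y := hy
      bound_x := fun x hx0 y hy0 => (hL z x hx0 y hy0).1
      bound_y := fun x hx0 y hy0 => (hL z x hx0 y hy0).2 }

theorem integral_mem_submodule {k : ℕ} {V : Submodule ℝ (Euc k)} {g : Z → Euc k}
    (hg : Integrable g P) (hV : ∀ z, g z ∈ V) : ∫ z, g z ∂P ∈ V := by
  have h1 := V.starProjection.integral_comp_comm hg
  have h2 : (fun z => V.starProjection (g z)) = g :=
    funext fun z => Submodule.starProjection_eq_self_iff.2 (hV z)
  rw [h2] at h1
  rw [h1]
  exact Submodule.starProjection_apply_mem _ _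

theorem integral_sub_sub_inner {k : ℕ} {a b : Z → ℝ} {g : Z → Euc k} (ha : Integrable a P)
    (hb : Integrable b P) (hg : Integrable g P) (v : Euc k) :
    ∫ z, (a z - b z - ⟪g z, v⟫_ℝ) ∂P = ∫ z, a z ∂P - ∫ z, b z ∂P - ⟪∫ z, g z ∂P, v⟫_ℝ := by
  rw [integral_sub (f := fun z => a z - b z) (ha.sub hb) (hg.inner_const v), integral_sub ha hb]
  congr 1
  simp only [real_inner_comm v]
  exact integral_inner hg v

theorem norm_integral_sub_le_of_forall [IsProbabilityMeasure P] {E : Type*} [NormedAddCommGroup E]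
    [NormedSpace ℝ E] {a b : Z → E} (ha : Integrable a P) (hb : Integrable b P) {C : ℝ}
    (h : ∀ z, ‖a z - b z‖ ≤ C) : ‖∫ z, a z ∂P - ∫ z, b z ∂P‖ ≤ C := by
  rw [← integral_sub ha hb]
  simpa using norm_integral_le_of_norm_le_const (μ := P) (Filter.Eventually.of_forall h)

/-- Each field is a subspace membership, an inequality linear in the function and gradients, or a
bound on an absolute value or norm of such an expression; all survive averaging over a probability
measure. Taking the measure to be `P` or a normalized counting measure covers both the population
and the empirical objective. -/
theorem IsSmoothSaddle.integral [IsProbabilityMeasure P] {gx : Euc d → Euc d' → Z → Euc d}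
    {gy : Euc d → Euc d' → Z → Euc d'}
    (h : ∀ z, IsSmoothSaddle X Y (fun x y => f x y z) (fun x y => gx x y z)
      (fun x y => gy x y z) μ β L)
    (hf : ∀ x ∈ X, ∀ y ∈ Y, Integrable (f x y) P)
    (hgx : ∀ x ∈ X, ∀ y ∈ Y, Integrable (gx x y) P)
    (hgy : ∀ x ∈ X, ∀ y ∈ Y, Integrable (gy x y) P) :
    IsSmoothSaddle X Y (popRisk P f) (fun x y => ∫ z, gx x y z ∂P) (fun x y => ∫ z, gy x y z ∂P)
      μ β L where
  mem_x x hx y hy := integral_mem_submodule (hgx x hx y hy) fun z => (h z).mem_x x hx y hy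
  mem_y x hx y hy := integral_mem_submodule (hgy x hx y hy) fun z => (h z).mem_y x hx y hy
  quad_x x hx x' hx' y hy := by
    rw [popRisk, popRisk,
      ← integral_sub_sub_inner (hf x' hx' y hy) (hf x hx y hy) (hgx x hx y hy)]
    have := norm_integral_le_of_norm_le_const (μ := P) (Filter.Eventually.of_forall fun z =>
      (Real.norm_eq_abs _).trans_le ((h z).quad_x x hx x' hx' y hy))
    simpa using this
  quad_y x hx y hy y' hy' := by
    rw [popRisk, popRisk,
      ← integral_sub_sub_inner (hf x hx y' hy') (hf x hx y hy) (hgy x hx y hy)]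
    have := norm_integral_le_of_norm_le_const (μ := P) (Filter.Eventually.of_forall fun z =>
      (Real.norm_eq_abs _).trans_le ((h z).quad_y x hx y hy y' hy'))
    simpa using this
  concave x hx y hy y' hy' := by
    have h1 := integral_sub_sub_inner (hf x hx y' hy') (hf x hx y hy) (hgy x hx y hy) (y' - y)
    have h2 : ∫ z, (f x y' z - f x y z - ⟪gy x y z, y' - y⟫_ℝ) ∂P ≤
        ∫ _, -(μ / 2 * ‖y' - y‖ ^ 2) ∂P := by
      refine integral_mono (((hf x hx y' hy').sub (hf x hx y hy)).sub
        ((hgy x hx y hy).inner_const _)) (integrable_const _) fun z => ?_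
      have := (h z).concave x hx y hy y' hy'
      simp only at this ⊢
      linarith
    rw [h1] at h2
    simp only [integral_const, probReal_univ, one_smul] at h2
    simp only [popRisk]
    linarith
  lip_x x hx x' hx' y hy y' hy' := norm_integral_sub_le_of_forall (hgx x hx y hy)
    (hgx x' hx' y' hy') fun z => (h z).lip_x x hx x' hx' y hy y' hy'
  lip_y x hx x' hx' y hy y' hy' := norm_integral_sub_le_of_forall (hgy x hx y hy)
    (hgy x' hx' y' hy') fun z => (h z).lip_y x hx x' hx' y hy y' hy'
  bound_x x hx y hy := by
    simpa using norm_integral_le_of_norm_le_const (μ := P)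
      (Filter.Eventually.of_forall fun z => (h z).bound_x x hx y hy)
  bound_y x hx y hy := by
    simpa using norm_integral_le_of_norm_le_const (μ := P)
      (Filter.Eventually.of_forall fun z => (h z).bound_y x hx y hy)

theorem IsNCSC.measurable_gradX (h : IsNCSC P X Y f μ β DX DY) {x : Euc d} (hx : x ∈ X)
    {y : Euc d'} (hy : y ∈ Y) : Measurable fun z => gradX X (fun x y => f x y z) x y :=
  measurable_gradOn h.convex_X (fun z => h.differentiableOn_left z hy)
    (fun x hx => h.measurable x hx y hy) hx

theorem IsNCSC.measurable_gradY (h : IsNCSC P X Y f μ β DX DY) {x : Euc d} (hx : x ∈ X)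
    {y : Euc d'} (hy : y ∈ Y) : Measurable fun z => gradY Y (fun x y => f x y z) x y :=
  measurable_gradOn h.convex_Y (fun z => h.differentiableOn_right z hx)
    (fun y hy => h.measurable x hx y hy) hy

theorem IsNCSC.isSmoothSaddle_popRisk [IsProbabilityMeasure P] (h : IsNCSC P X Y f μ β DX DY)
    (hL : IsLip X Y f L) (hβ : 0 ≤ β) :
    IsSmoothSaddle X Y (popRisk P f) (fun x y => ∫ z, gradX X (fun x y => f x y z) x y ∂P)
      (fun x y => ∫ z, gradY Y (fun x y => f x y z) x y ∂P) μ β L :=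
  IsSmoothSaddle.integral (h.isSmoothSaddle hL hβ) h.integrable
    (fun x hx y hy => Integrable.of_bound (h.measurable_gradX hx hy).aestronglyMeasurable L
      (Filter.Eventually.of_forall fun z => (hL z x hx y hy).1))
    (fun x hx y hy => Integrable.of_bound (h.measurable_gradY hx hy).aestronglyMeasurable L
      (Filter.Eventually.of_forall fun z => (hL z x hx y hy).2))

theorem integral_smul_count_fin {E : Type*} [NormedAddCommGroup E] [NormedSpace ℝ E]
    [CompleteSpace E] {n : ℕ} (v : Fin n → E) :
    ∫ i, v i ∂((n : ENNReal)⁻¹ • Measure.count) = (1 / (n : ℝ)) • ∑ i, v i := by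
  rw [integral_smul_measure, integral_count]
  simp

theorem IsNCSC.isSmoothSaddle_empRisk (h : IsNCSC P X Y f μ β DX DY)
    (hL : IsLip X Y f L) (hβ : 0 ≤ β) {n : ℕ} (hn : 0 < n) (S : Fin n → Z) :
    IsSmoothSaddle X Y (empRisk f S)
      (fun x y => (1 / (n : ℝ)) • ∑ i, gradX X (fun x y => f x y (S i)) x y)
      (fun x y => (1 / (n : ℝ)) • ∑ i, gradY Y (fun x y => f x y (S i)) x y) μ β L := by
  have hn' : (n : ENNReal) ≠ 0 := by exact_mod_cast hn.ne'
  have hP : IsProbabilityMeasure ((n : ENNReal)⁻¹ • (Measure.count : Measure (Fin n))) := by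
    refine ⟨?_⟩
    simp only [Measure.smul_apply, smul_eq_mul, Measure.count_univ, ENat.card_eq_coe_fintype_card,
      Fintype.card_fin, ENat.toENNReal_coe]
    exact ENNReal.inv_mul_cancel hn' (ENNReal.natCast_ne_top n)
  -- The empirical objective is the population objective of the uniform measure on the sample
  -- indices.
  have key := IsSmoothSaddle.integral (P := (n : ENNReal)⁻¹ • (Measure.count : Measure (Fin n)))
    (f := fun x y i => f x y (S i)) (fun i => h.isSmoothSaddle hL hβ (S i))
    (fun _ _ _ _ => Integrable.of_finite) (fun _ _ _ _ => Integrable.of_finite)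
    (fun _ _ _ _ => Integrable.of_finite)
  have e : popRisk ((n : ENNReal)⁻¹ • (Measure.count : Measure (Fin n)))
      (fun x y i => f x y (S i)) = empRisk f S := by
    funext x y
    exact integral_smul_count_fin _
  simp only [integral_smul_count_fin] at key
  rwa [e] at key

end Construction

/-! ### Maximizers and the gradient of the primal function. -/

section Saddle

variable {d d' : ℕ} {X : Set (Euc d)} {Y : Set (Euc d')}
  {F : Euc d → Euc d' → ℝ} {Gx : Euc d → Euc d' → Euc d} {Gy : Euc d → Euc d' → Euc d'}
  {μ β L : ℝ}

/-- `ys x` maximizes `F x` over `Y`, for every `x ∈ X`. -/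
def IsArgmax (X : Set (Euc d)) (Y : Set (Euc d')) (F : Euc d → Euc d' → ℝ)
    (ys : Euc d → Euc d') : Prop :=
  ∀ x ∈ X, ys x ∈ Y ∧ ∀ y ∈ Y, F x y ≤ F x (ys x)

theorem IsSmoothSaddle.exists_isArgmax (h : IsSmoothSaddle X Y F Gx Gy μ β L) (hY : IsCompact Y)
    (hne : Y.Nonempty) : ∃ ys, IsArgmax X Y F ys := by
  have key : ∀ x, ∃ y, x ∈ X → y ∈ Y ∧ ∀ y' ∈ Y, F x y' ≤ F x y := by
    intro x
    by_cases hx : x ∈ X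
    · have hc : ContinuousOn (F x) Y := by
        intro y hy
        have h1 : Filter.Tendsto (fun y' => |⟪Gy x y, y' - y⟫_ℝ| + β / 2 * ‖y' - y‖ ^ 2)
            (nhdsWithin y Y) (nhds 0) := by
          have : Continuous fun y' : Euc d' => |⟪Gy x y, y' - y⟫_ℝ| + β / 2 * ‖y' - y‖ ^ 2 := by
            fun_prop
          simpa using (this.tendsto y).mono_left nhdsWithin_le_nhds
        refine tendsto_iff_dist_tendsto_zero.2 (squeeze_zero' (by simp) ?_ h1)
        filter_upwards [self_mem_nhdsWithin] with y' hy'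
        rw [Real.dist_eq]
        have h2 := h.quad_y x hx y hy y' hy'
        have h3 := abs_sub_abs_le_abs_sub (F x y' - F x y) ⟪Gy x y, y' - y⟫_ℝ
        linarith
      obtain ⟨y, hy, hm⟩ := hY.exists_isMaxOn hne hc
      exact ⟨y, fun _ => ⟨hy, fun y' hy' => hm hy'⟩⟩
    · exact ⟨0, fun h => absurd h hx⟩
  choose ys hys using key
  exact ⟨ys, hys⟩

theorem IsArgmax.primal_eq {ys : Euc d → Euc d'} (hys : IsArgmax X Y F ys) {x : Euc d}
    (hx : x ∈ X) : primal Y F x = F x (ys x) := by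
  refine IsGreatest.csSup_eq ⟨⟨_, (hys x hx).1, rfl⟩, ?_⟩
  rintro _ ⟨y, hy, rfl⟩
  exact (hys x hx).2 y hy

theorem nonpos_of_forall_le_mul {a K : ℝ} (h : ∀ t : ℝ, 0 < t → t ≤ 1 → a ≤ K * t) : a ≤ 0 := by
  by_contra! ha
  have h1 := h 1 one_pos le_rfl
  have hK : 0 < K := by linarith
  have h2 := h (a / (2 * K)) (by positivity) (by rw [div_le_one (by positivity)]; linarith)
  have : K * (a / (2 * K)) = a / 2 := by field_simp
  linarith

/-- First-order optimality: a move of length `t` towards `y` cannot increase `F x`, and the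
remainder is of order `t²`. -/
theorem IsSmoothSaddle.inner_argmax_nonpos (h : IsSmoothSaddle X Y F Gx Gy μ β L)
    (hY : Convex ℝ Y) {ys : Euc d → Euc d'} (hys : IsArgmax X Y F ys) {x : Euc d} (hx : x ∈ X)
    {y : Euc d'} (hy : y ∈ Y) : ⟪Gy x (ys x), y - ys x⟫_ℝ ≤ 0 := by
  refine nonpos_of_forall_le_mul (K := β / 2 * ‖y - ys x‖ ^ 2) fun t ht ht1 => ?_
  obtain ⟨h0, hmax⟩ := hys x hx
  have hmem := hY.add_smul_sub_mem h0 hy ⟨ht.le, ht1⟩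
  have h1 := (abs_le.1 (h.quad_y x hx _ h0 _ hmem)).1
  have h2 := hmax _ hmem
  rw [add_sub_cancel_left, inner_smul_right, norm_smul, Real.norm_of_nonneg ht.le] at h1
  have h3 : t * ⟪Gy x (ys x), y - ys x⟫_ℝ ≤ t * (β / 2 * ‖y - ys x‖ ^ 2 * t) := by
    linear_combination h1 + h2
  exact le_of_mul_le_mul_left h3 ht

theorem IsSmoothSaddle.inner_sub_le (h : IsSmoothSaddle X Y F Gx Gy μ β L) {x : Euc d}
    (hx : x ∈ X) {y y' : Euc d'} (hy : y ∈ Y) (hy' : y' ∈ Y) :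
    μ * ‖y - y'‖ ^ 2 ≤ ⟪Gy x y', y - y'⟫_ℝ - ⟪Gy x y, y - y'⟫_ℝ := by
  have h1 := h.concave x hx y hy y' hy'
  have h2 := h.concave x hx y' hy' y hy
  rw [← neg_sub y y', inner_neg_right, norm_neg] at h1
  linarith

/-- Stability of maximizers of strongly concave functions under perturbation of the gradient. -/
theorem IsSmoothSaddle.mul_norm_argmax_sub_le (h : IsSmoothSaddle X Y F Gx Gy μ β L)
    (hY : Convex ℝ Y) {ys : Euc d → Euc d'} (hys : IsArgmax X Y F ys)
    {F' : Euc d → Euc d' → ℝ} {Gx' : Euc d → Euc d' → Euc d} {Gy' : Euc d → Euc d' → Euc d'}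
    (h' : IsSmoothSaddle X Y F' Gx' Gy' μ β L) {ys' : Euc d → Euc d'} (hys' : IsArgmax X Y F' ys')
    {x x' : Euc d} (hx : x ∈ X) (hx' : x' ∈ X) :
    μ * ‖ys x - ys' x'‖ ≤ ‖Gy x (ys' x') - Gy' x' (ys' x')‖ := by
  have m1 := (hys x hx).1
  have m2 := (hys' x' hx').1
  -- Each optimality condition is tested at the other maximizer; strong monotonicity of the gradient
  -- of `F x` then bounds the squared distance.
  have h1 := h.inner_argmax_nonpos hY hys hx m2
  have h2 := h'.inner_argmax_nonpos hY hys' hx' m1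
  have h3 := h.inner_sub_le hx m1 m2
  rw [← neg_sub, inner_neg_right] at h1
  have h4 : ⟪Gy x (ys' x') - Gy' x' (ys' x'), ys x - ys' x'⟫_ℝ ≤
      ‖Gy x (ys' x') - Gy' x' (ys' x')‖ * ‖ys x - ys' x'‖ := real_inner_le_norm _ _
  rw [inner_sub_left] at h4
  have h5 : μ * ‖ys x - ys' x'‖ * ‖ys x - ys' x'‖ ≤
      ‖Gy x (ys' x') - Gy' x' (ys' x')‖ * ‖ys x - ys' x'‖ := by
    linear_combination h1 + h2 + h3 + h4
  rcases (norm_nonneg (ys x - ys' x')).eq_or_lt with h0 | h0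
  · rw [← h0, mul_zero]; exact norm_nonneg _
  · exact le_of_mul_le_mul_right h5 h0

theorem IsSmoothSaddle.norm_argmax_sub_le (h : IsSmoothSaddle X Y F Gx Gy μ β L) (hμ : 0 < μ)
    (hY : Convex ℝ Y) {ys : Euc d → Euc d'} (hys : IsArgmax X Y F ys)
    {x x' : Euc d} (hx : x ∈ X) (hx' : x' ∈ X) :
    ‖ys x - ys x'‖ ≤ β / μ * ‖x - x'‖ := by
  have h1 := h.mul_norm_argmax_sub_le hY hys h hys hx hx'
  have m := (hys x' hx').1
  have h2 := h.lip_y x hx x' hx' _ m _ m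
  rw [sub_self, norm_zero, add_zero] at h2
  rw [div_mul_eq_mul_div, le_div_iff₀ hμ]
  linarith

/-- Danskin's argument with a quantitative remainder. Keeping the maximizer of `x` at `x'` gives the
lower bound. Keeping that of `x'` at `x` gives the upper bound; replacing `ys x'` by `ys x` in the
gradient costs `β (β/μ) ‖x' - x‖²`, by the Lipschitz bound for maximizers. -/
theorem IsSmoothSaddle.abs_primal_sub_le (h : IsSmoothSaddle X Y F Gx Gy μ β L) (hμ : 0 < μ)
    (hβ : 0 < β) (hY : Convex ℝ Y) {ys : Euc d → Euc d'} (hys : IsArgmax X Y F ys)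
    {x x' : Euc d} (hx : x ∈ X) (hx' : x' ∈ X) :
    |primal Y F x' - primal Y F x - ⟪Gx x (ys x), x' - x⟫_ℝ| ≤
      β * (β / μ + 1 / 2) * ‖x' - x‖ ^ 2 := by
  rw [hys.primal_eq hx, hys.primal_eq hx']
  obtain ⟨m, hm⟩ := hys x hx
  obtain ⟨m', hm'⟩ := hys x' hx'
  have h1 := (abs_le.1 (h.quad_x x hx x' hx' _ m)).1
  have h2 := (abs_le.1 (h.quad_x x hx x' hx' _ m')).2
  have h3 := hm _ m'
  have h4 := hm' _ m
  have h5 : ⟪Gx x (ys x') - Gx x (ys x), x' - x⟫_ℝ ≤ β * (β / μ) * ‖x' - x‖ ^ 2 := by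
    calc _ ≤ ‖Gx x (ys x') - Gx x (ys x)‖ * ‖x' - x‖ := real_inner_le_norm _ _
      _ ≤ β * (β / μ * ‖x' - x‖) * ‖x' - x‖ := by
        gcongr
        refine (h.lip_x x hx x hx _ m' _ m).trans ?_
        rw [sub_self, norm_zero, zero_add]
        gcongr
        exact h.norm_argmax_sub_le hμ hY hys hx' hx
      _ = _ := by ring
  rw [inner_sub_left] at h5
  have h6 : 0 ≤ β * (β / μ) * ‖x' - x‖ ^ 2 := by positivity
  refine abs_le.2 ⟨?_, ?_⟩ <;> linarith

theorem IsSmoothSaddle.gradOn_primal (h : IsSmoothSaddle X Y F Gx Gy μ β L) (hμ : 0 < μ)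
    (hβ : 0 < β) (hX : Convex ℝ X) (hY : Convex ℝ Y) {ys : Euc d → Euc d'}
    (hys : IsArgmax X Y F ys) {x : Euc d} (hx : x ∈ X) :
    gradOn X (primal Y F) x = Gx x (ys x) :=
  gradOn_eq_of_abs_sub_sub_inner_le hX hx (h.mem_x x hx _ (hys x hx).1)
    fun _ hx' => h.abs_primal_sub_le hμ hβ hY hys hx hx'

theorem IsSmoothSaddle.gradX_eq (h : IsSmoothSaddle X Y F Gx Gy μ β L) (hX : Convex ℝ X)
    {x : Euc d} (hx : x ∈ X) {y : Euc d'} (hy : y ∈ Y) : gradX X F x y = Gx x y :=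
  gradOn_eq_of_abs_sub_sub_inner_le hX hx (h.mem_x x hx y hy)
    fun x' hx' => h.quad_x x hx x' hx' y hy

theorem IsSmoothSaddle.gradY_eq (h : IsSmoothSaddle X Y F Gx Gy μ β L) (hY : Convex ℝ Y)
    {x : Euc d} (hx : x ∈ X) {y : Euc d'} (hy : y ∈ Y) : gradY Y F x y = Gy x y :=
  gradOn_eq_of_abs_sub_sub_inner_le hY hy (h.mem_y x hx y hy)
    fun y' hy' => h.quad_y x hx y hy y' hy'

/-- The partial gradients of the two objectives are compared only at `ys x`, the maximizer for `F`.
With `F` the population objective this point is independent of the sample, so no uniformity over `Y`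
is needed. -/
theorem IsSmoothSaddle.norm_gradOn_primal_sub_le (h : IsSmoothSaddle X Y F Gx Gy μ β L)
    (hμ : 0 < μ) (hβ : 0 < β) (hX : Convex ℝ X) (hY : Convex ℝ Y) {ys : Euc d → Euc d'}
    (hys : IsArgmax X Y F ys)
    {F' : Euc d → Euc d' → ℝ} {Gx' : Euc d → Euc d' → Euc d} {Gy' : Euc d → Euc d' → Euc d'}
    (h' : IsSmoothSaddle X Y F' Gx' Gy' μ β L) {ys' : Euc d → Euc d'} (hys' : IsArgmax X Y F' ys')
    {x : Euc d} (hx : x ∈ X) :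
    ‖gradOn X (primal Y F') x - gradOn X (primal Y F) x‖ ≤
      β / μ * ‖Gy' x (ys x) - Gy x (ys x)‖ + ‖Gx' x (ys x) - Gx x (ys x)‖ := by
  rw [h.gradOn_primal hμ hβ hX hY hys hx, h'.gradOn_primal hμ hβ hX hY hys' hx]
  have m := (hys x hx).1
  have m' := (hys' x hx).1
  have h1 := h'.mul_norm_argmax_sub_le hY hys' h hys hx hx
  have h2 := h'.lip_x x hx x hx _ m' _ m
  rw [sub_self, norm_zero, zero_add] at h2
  have h3 : ‖ys' x - ys x‖ ≤ ‖Gy' x (ys x) - Gy x (ys x)‖ / μ := by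
    rw [le_div_iff₀ hμ]; linarith
  calc _ ≤ ‖Gx' x (ys' x) - Gx' x (ys x)‖ + ‖Gx' x (ys x) - Gx x (ys x)‖ :=
        norm_sub_le_norm_sub_add_norm_sub _ _ _
    _ ≤ β * (‖Gy' x (ys x) - Gy x (ys x)‖ / μ) + ‖Gx' x (ys x) - Gx x (ys x)‖ := by
        gcongr
        exact h2.trans (by gcongr)
    _ = _ := by ring

end Saddle

/-! ### Descent of the potential along gradient descent ascent. -/

section Descent

variable {d d' : ℕ} {X : Set (Euc d)} {Y : Set (Euc d')}
  {F : Euc d → Euc d' → ℝ} {Gx : Euc d → Euc d' → Euc d} {Gy : Euc d → Euc d' → Euc d'}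
  {μ β L : ℝ}

/-- A gradient ascent step that stays in `Y` contracts the distance to the maximizer. -/
theorem IsSmoothSaddle.ascent_contraction (h : IsSmoothSaddle X Y F Gx Gy μ β L) (hβ : 0 < β)
    (hY : Convex ℝ Y) {ys : Euc d → Euc d'} (hys : IsArgmax X Y F ys) {x : Euc d} (hx : x ∈ X)
    {y : Euc d'} (hy : y ∈ Y) (hy' : y + (1 / β) • Gy x y ∈ Y) :
    (β + μ) * ‖y + (1 / β) • Gy x y - ys x‖ ^ 2 ≤ (β - μ) * ‖y - ys x‖ ^ 2 := by
  obtain ⟨m, hm⟩ := hys x hx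
  obtain ⟨p, hp⟩ : ∃ p, p = (1 / β) • Gy x y := ⟨_, rfl⟩
  have hG : Gy x y = β • p := by rw [hp, smul_smul, mul_one_div_cancel hβ.ne', one_smul]
  rw [← hp] at hy' ⊢
  -- Strong concavity at `y` and at the maximizer, optimality of the maximizer, and the smoothness
  -- lower bound for the ascent step add up to the contraction.
  have h1 := h.concave x hx y hy _ m
  have h2 := h.concave x hx _ m _ hy'
  have h3 := h.inner_argmax_nonpos hY hys hx hy'
  have h4 := (abs_le.1 (h.quad_y x hx y hy _ hy')).1
  rw [hG, add_sub_cancel_left, real_inner_smul_left, real_inner_self_eq_norm_sq] at h4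
  rw [hG, real_inner_smul_left] at h1
  have e1 : ‖y + p - ys x‖ ^ 2 = ‖p‖ ^ 2 - 2 * ⟪p, ys x - y⟫_ℝ + ‖ys x - y‖ ^ 2 := by
    rw [← norm_sub_sq_real]; congr 2; abel
  rw [norm_sub_rev y (ys x)]
  rw [e1] at h2 ⊢
  linarith

theorem add_sq_le_mul_sq_add {a b θ : ℝ} (hθ : 0 < θ) :
    (a + b) ^ 2 ≤ (1 + θ) * a ^ 2 + (1 + 1 / θ) * b ^ 2 := by
  have : (1 + θ) * a ^ 2 + (1 + 1 / θ) * b ^ 2 - (a + b) ^ 2 = (θ * a - b) ^ 2 / θ := by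
    field_simp; ring
  have h2 : 0 ≤ (θ * a - b) ^ 2 / θ := by positivity
  linarith

/-- With `κ = β/μ`, the ascent step contracts the squared distance to the old maximizer by `(κ -
1)/(κ + 1)`, while the maximizer moves by at most `κ‖x' - x‖`. -/
theorem IsSmoothSaddle.tracking_step (h : IsSmoothSaddle X Y F Gx Gy μ β L) (hμ : 0 < μ)
    (hβ : 0 < β) (hY : Convex ℝ Y) {ys : Euc d → Euc d'} (hys : IsArgmax X Y F ys)
    {x x' : Euc d} (hx : x ∈ X) (hx' : x' ∈ X) {y : Euc d'} (hy : y ∈ Y)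
    (hy' : y + (1 / β) • Gy x y ∈ Y) :
    ‖y + (1 / β) • Gy x y - ys x'‖ ^ 2 ≤ (1 - 1 / (β / μ + 1)) * ‖y - ys x‖ ^ 2 +
      (β / μ + 2) * (β / μ) ^ 2 * ‖x' - x‖ ^ 2 := by
  set κ := β / μ with hκ
  have hκ0 : 0 < κ := by positivity
  have h1 := h.ascent_contraction hβ hY hys hx hy hy'
  have h2 := h.norm_argmax_sub_le hμ hY hys hx hx'
  rw [norm_sub_rev x x', ← hκ] at h2
  set a := ‖y + (1 / β) • Gy x y - ys x‖
  set b := ‖y - ys x‖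
  have h3 : ‖y + (1 / β) • Gy x y - ys x'‖ ≤ a + κ * ‖x' - x‖ :=
    (norm_sub_le_norm_sub_add_norm_sub _ (ys x) _).trans (by gcongr)
  have hβκ : β = κ * μ := by rw [hκ]; field_simp
  have h4 : (κ + 1) * a ^ 2 ≤ (κ - 1) * b ^ 2 := by
    rw [hβκ] at h1
    refine le_of_mul_le_mul_left ?_ hμ
    linear_combination h1
  have h5 : (1 + 1 / (κ + 1)) * a ^ 2 ≤ (1 - 1 / (κ + 1)) * b ^ 2 := by
    have e : 1 + 1 / (κ + 1) = (κ + 2) / (κ + 1) := by field_simp; ring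
    have e' : 1 - 1 / (κ + 1) = κ / (κ + 1) := by field_simp; ring
    rw [e, e', div_mul_eq_mul_div, div_mul_eq_mul_div]
    refine div_le_div_of_nonneg_right ?_ (by positivity)
    refine le_of_mul_le_mul_left ?_ (by positivity : 0 < κ + 1)
    have h6 := mul_le_mul_of_nonneg_left h4 (by positivity : 0 ≤ κ + 2)
    have h7 : (κ + 2) * ((κ - 1) * b ^ 2) ≤ (κ + 1) * (κ * b ^ 2) := by
      have : 0 ≤ b ^ 2 := sq_nonneg b
      linear_combination 2 * this
    linear_combination h6 + h7
  calc _ ≤ (a + κ * ‖x' - x‖) ^ 2 := by gcongr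
    -- Young's inequality with `θ = 1/(κ + 1)`, which uses up only part of the contraction.
    _ ≤ (1 + 1 / (κ + 1)) * a ^ 2 + (1 + 1 / (1 / (κ + 1))) * (κ * ‖x' - x‖) ^ 2 :=
      add_sq_le_mul_sq_add (by positivity)
    _ ≤ _ := by
      rw [one_div_one_div, mul_pow]
      linear_combination h5

/-- One step of gradient descent ascent decreases the potential `Φ(x) + c ‖y - y*(x)‖²`. -/
theorem IsSmoothSaddle.potential_step (h : IsSmoothSaddle X Y F Gx Gy μ β L) (hμ : 0 < μ)
    (hβ : 0 < β) (hX : Convex ℝ X) (hY : Convex ℝ Y) {ys : Euc d → Euc d'}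
    (hys : IsArgmax X Y F ys) {η c : ℝ} (hη : η = 1 / (16 * (β / μ + 1) ^ 2 * β))
    (hc : c = η * β ^ 2 * (β / μ + 1) / 2) {x : Euc d} (hx : x ∈ X) {y : Euc d'} (hy : y ∈ Y)
    (hx' : x - η • Gx x y ∈ X) (hy' : y + (1 / β) • Gy x y ∈ Y) :
    primal Y F (x - η • Gx x y) + c * ‖y + (1 / β) • Gy x y - ys (x - η • Gx x y)‖ ^ 2 +
        η / 2 * ‖gradOn X (primal Y F) x‖ ^ 2 ≤
      primal Y F x + c * ‖y - ys x‖ ^ 2 := by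
  rw [h.gradOn_primal hμ hβ hX hY hys hx]
  have m := (hys x hx).1
  have h1 := (abs_le.1 (h.abs_primal_sub_le hμ hβ hY hys hx hx')).2
  have h2 := h.tracking_step hμ hβ hY hys hx hx' hy hy'
  have h3 := h.lip_x x hx x hx y hy _ m
  rw [sub_self, norm_zero, zero_add] at h3
  have h4 : ‖Gx x y - Gx x (ys x)‖ ^ 2 ≤ β ^ 2 * ‖y - ys x‖ ^ 2 := by
    rw [← mul_pow]; gcongr
  rw [norm_sub_sq_real] at h4
  set κ := β / μ with hκ
  have hκ0 : 0 < κ := by positivity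
  have hη0 : 0 < η := by rw [hη]; positivity
  have hc0 : 0 ≤ c := by rw [hc]; positivity
  rw [sub_sub_cancel_left] at h1 h2
  rw [norm_neg, norm_smul, Real.norm_of_nonneg hη0.le, mul_pow] at h1 h2
  rw [inner_neg_right, real_inner_smul_right, real_inner_comm] at h1
  set γ := ‖Gx x y‖ ^ 2
  set D := ‖y - ys x‖ ^ 2
  have hγ : 0 ≤ γ := sq_nonneg _
  have h5 := mul_le_mul_of_nonneg_left h2 hc0
  have hηβ : 16 * (κ + 1) ^ 2 * (β * η) = 1 := by rw [hη]; field_simp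
  -- The value of `c` makes the contraction of the distance term pay exactly for the error of using
  -- `Gx x y` in place of the primal gradient.
  have hcθ : c * (1 / (κ + 1)) = η * β ^ 2 / 2 := by rw [hc]; field_simp
  set u := (κ + 1) ^ 2 * (β * η) with hu
  have hu1 : u = 1 / 16 := by linarith
  have h6 : β * (κ + 1 / 2) * η ≤ 1 / 16 := by
    rw [← hu1, hu]
    have : 0 < β * η := by positivity
    have : κ + 1 / 2 ≤ (κ + 1) ^ 2 := by nlinarith
    calc β * (κ + 1 / 2) * η = (κ + 1 / 2) * (β * η) := by ring
      _ ≤ _ := by gcongr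
  have h7 : c * ((κ + 2) * κ ^ 2) * η ≤ 1 / 256 := by
    have : (1 / 256 : ℝ) = u ^ 2 := by rw [hu1]; norm_num
    rw [this, hu, hc]
    calc η * β ^ 2 * (κ + 1) / 2 * ((κ + 2) * κ ^ 2) * η
        = ((κ + 1) * ((κ + 2) / 2) * κ ^ 2) * (β * η) ^ 2 := by ring
      _ ≤ ((κ + 1) * (κ + 1) * (κ + 1) ^ 2) * (β * η) ^ 2 := by gcongr <;> linarith
      _ = _ := by ring
  -- The step size makes both terms quadratic in the `x`-step small enough to be absorbed by the
  -- `-(η/2)‖Gx x y‖²` that polarization of the inner product provides.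
  have h8 : (β * (κ + 1 / 2) * η + c * ((κ + 2) * κ ^ 2) * η) * (η * γ) ≤ 1 / 2 * (η * γ) := by
    gcongr
    linarith
  have h9 := mul_le_mul_of_nonneg_left h4 hη0.le
  have h10 : c * (1 / (κ + 1)) * D = η * β ^ 2 / 2 * D := by rw [hcθ]
  linear_combination h1 + h5 + h8 + h9 / 2 - h10

theorem IsSmoothSaddle.sum_norm_gradOn_primal_sq_le (h : IsSmoothSaddle X Y F Gx Gy μ β L)
    (hμ : 0 < μ) (hβ : 0 < β) (hX : Convex ℝ X) (hY : Convex ℝ Y) {ys : Euc d → Euc d'}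
    (hys : IsArgmax X Y F ys) {DX DY : ℝ} (hDX : ∀ x ∈ X, ‖x‖ ^ 2 ≤ DX)
    (hDY : ∀ y ∈ Y, ‖y‖ ^ 2 ≤ DY) {η c : ℝ} (hη : η = 1 / (16 * (β / μ + 1) ^ 2 * β))
    (hc : c = η * β ^ 2 * (β / μ + 1) / 2) {T : ℕ} (hT : 0 < T)
    (hruns : ∀ t < T, (gda X Y F η (1 / β) t).1 ∈ X ∧ (gda X Y F η (1 / β) t).2 ∈ Y) :
    ∑ t ∈ Finset.range T, ‖gradOn X (primal Y F) (gda X Y F η (1 / β) t).1‖ ^ 2 ≤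
      2 / η * (2 * L * √DX + 4 * (β * (β / μ + 1 / 2)) * DX + 4 * c * DY) + L ^ 2 := by
  -- Only `T - 1` steps are telescoped, since the iterate after the last one may leave `X × Y`. The
  -- last gradient is bounded by `L`, whence the summand `L ^ 2`.
  obtain ⟨m, rfl⟩ : ∃ m, T = m + 1 := ⟨T - 1, by omega⟩
  have hη0 : 0 < η := by rw [hη]; positivity
  have hc0 : 0 ≤ c := by rw [hc]; positivity
  set p := gda X Y F η (1 / β) with hp
  have key : ∀ j ≤ m, primal Y F (p j).1 + c * ‖(p j).2 - ys (p j).1‖ ^ 2 +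
      η / 2 * ∑ t ∈ Finset.range j, ‖gradOn X (primal Y F) (p t).1‖ ^ 2 ≤
      primal Y F (p 0).1 + c * ‖(p 0).2 - ys (p 0).1‖ ^ 2 := by
    intro j
    induction j with
    | zero => intro _; simp
    | succ j ih =>
      intro hj
      obtain ⟨hx, hy⟩ := hruns j (by omega)
      obtain ⟨hx', hy'⟩ := hruns (j + 1) (by omega)
      have e : p (j + 1) = ((p j).1 - η • Gx (p j).1 (p j).2,
          (p j).2 + (1 / β) • Gy (p j).1 (p j).2) := by
        rw [← h.gradX_eq hX hx hy, ← h.gradY_eq hY hx hy]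
        rfl
      have ih' := ih (by omega)
      rw [e] at hx' hy' ⊢
      have hs := h.potential_step hμ hβ hX hY hys hη hc hx hy hx' hy'
      rw [Finset.sum_range_succ]
      simp only
      linarith
  have hk := key m le_rfl
  obtain ⟨hx0, hy0⟩ := hruns 0 (by omega)
  obtain ⟨hxm, hym⟩ := hruns m (by omega)
  have m0 := (hys _ hx0).1
  have hxb : ∀ x ∈ X, ‖x‖ ≤ √DX := fun x hx => Real.le_sqrt_of_sq_le (hDX x hx)
  have hsq : ‖(p m).1 - (p 0).1‖ ≤ 2 * √DX :=
    (norm_sub_le _ _).trans (by linarith [hxb _ hxm, hxb _ hx0])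
  have hDX0 : 0 ≤ DX := (sq_nonneg _).trans (hDX _ hx0)
  have hb := (abs_le.1 (h.abs_primal_sub_le hμ hβ hY hys hx0 hxm)).1
  have hi := (abs_le.1 (abs_real_inner_le_norm (Gx (p 0).1 (ys (p 0).1))
    ((p m).1 - (p 0).1))).1
  have hi2 : ‖Gx (p 0).1 (ys (p 0).1)‖ * ‖(p m).1 - (p 0).1‖ ≤ L * (2 * √DX) :=
    mul_le_mul (h.bound_x _ hx0 _ m0) hsq (norm_nonneg _)
      ((norm_nonneg _).trans (h.bound_x _ hx0 _ m0))
  have hb2 : β * (β / μ + 1 / 2) * ‖(p m).1 - (p 0).1‖ ^ 2 ≤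
      β * (β / μ + 1 / 2) * (2 * √DX) ^ 2 := by gcongr
  rw [mul_pow, Real.sq_sqrt hDX0] at hb2
  have hd0 : ‖(p 0).2 - ys (p 0).1‖ ^ 2 ≤ 4 * DY := by
    have h1 := norm_sub_le (p 0).2 (ys (p 0).1)
    have h2 := pow_le_pow_left₀ (norm_nonneg _) h1 2
    nlinarith [hDY _ hy0, hDY _ m0, sq_nonneg (‖(p 0).2‖ - ‖ys (p 0).1‖)]
  have hd1 := mul_le_mul_of_nonneg_left hd0 hc0
  have hdm : 0 ≤ c * ‖(p m).2 - ys (p m).1‖ ^ 2 := by positivity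
  have hlast : ‖gradOn X (primal Y F) (p m).1‖ ^ 2 ≤ L ^ 2 := by
    rw [h.gradOn_primal hμ hβ hX hY hys hxm]
    exact pow_le_pow_left₀ (norm_nonneg _) (h.bound_x _ hxm _ (hys _ hxm).1) 2
  rw [Finset.sum_range_succ]
  refine add_le_add ?_ hlast
  rw [div_mul_eq_mul_div, le_div_iff₀ hη0]
  linarith

end Descent

/-! ### Uniform convergence of the primal gradient. -/

section Deviation

variable {d d' : ℕ} {X : Set (Euc d)} {Y : Set (Euc d')} {Z : Type*} [MeasurableSpace Z]
  {P : Measure Z} [IsProbabilityMeasure P] {f : Euc d → Euc d' → Z → ℝ} {μ β L DX DY : ℝ}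

theorem measure_le_norm_average_sub_integral_le {k : ℕ} {g : Z → Euc k} (hg : Measurable g)
    (hL : 0 < L) (hb : ∀ z, ‖g z‖ ≤ L) {n : ℕ} (hn : 0 < n) {τ : ℝ} (hτ : 0 < τ) :
    (Measure.pi fun _ : Fin n => P)
        {S | τ ≤ ‖(1 / (n : ℝ)) • ∑ i, g (S i) - ∫ z, g z ∂P‖} ≤
      ENNReal.ofReal (2 * Real.exp (-(n * τ ^ 2 / (8 * L ^ 2)))) := by
  have hint : Integrable g P :=
    Integrable.of_bound hg.aestronglyMeasurable L (Filter.Eventually.of_forall hb)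
  have hI : ‖∫ z, g z ∂P‖ ≤ L := by
    simpa using norm_integral_le_of_norm_le_const (μ := P) (Filter.Eventually.of_forall hb)
  have key := measure_le_norm_average_le (P := P) (ξ := fun z => g z - ∫ z, g z ∂P) (M := 2 * L)
    (by positivity) (hg.sub_const _) (fun z => (norm_sub_le _ _).trans (by linarith [hb z]))
    (by rw [integral_sub hint (integrable_const _)]; simp) hn hτ
  have e : (2 * (2 * L) ^ 2) = 8 * L ^ 2 := by ring
  rw [e] at key
  have hn' : (n : ℝ) ≠ 0 := by exact_mod_cast hn.ne'
  have e2 : ∀ S : Fin n → Z, (1 / (n : ℝ)) • ∑ i, (g (S i) - ∫ z, g z ∂P) =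
      (1 / (n : ℝ)) • ∑ i, g (S i) - ∫ z, g z ∂P := by
    intro S
    rw [Finset.sum_sub_distrib, smul_sub, Finset.sum_const, Finset.card_univ, Fintype.card_fin,
      ← Nat.cast_smul_eq_nsmul ℝ, smul_smul, one_div_mul_cancel hn', one_smul]
  simpa only [e2] using key

/-- By `1 + u ≤ exp u`, the cardinality costs at most `exp(2R d / √A)`, and `d ≤ n A` bounds this
exponent by `2R n √A`. The extra `n √A ≥ n A` covers `log(4/δ)`. Working at scale `√A` thus avoids a
logarithm of `n`. -/
theorem four_mul_card_mul_exp_le {N A R δ : ℝ} {n d : ℕ} (hR : 0 ≤ R) (hn : 0 < n) (hδ : 0 < δ)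
    (hA : A = (d + Real.log (4 / δ)) / n) (hA0 : 0 < A) (hA1 : A ≤ 1)
    (hlog : 0 ≤ Real.log (4 / δ)) (hN : N ≤ (1 + 2 * R / √A) ^ d) :
    N * (4 * Real.exp (-(n * ((2 * R + 1) * √A)))) ≤ δ := by
  have hn' : (0 : ℝ) < n := by exact_mod_cast hn
  have hs : 0 < √A := Real.sqrt_pos.2 hA0
  have hss : √A * √A = A := Real.mul_self_sqrt hA0.le
  have hs1 : √A ≤ 1 := Real.sqrt_le_one.2 hA1
  have hnA : n * A = d + Real.log (4 / δ) := by rw [hA]; field_simp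
  have h1 : N ≤ Real.exp (d * (2 * R / √A)) := by
    refine hN.trans ?_
    rw [Real.exp_nat_mul]
    refine pow_le_pow_left₀ (by positivity) ?_ d
    linarith [Real.add_one_le_exp (2 * R / √A)]
  have h2 : d * (2 * R / √A) ≤ n * (2 * R * √A) := by
    rw [mul_div_assoc', div_le_iff₀ hs]
    calc (d : ℝ) * (2 * R) ≤ (n * A) * (2 * R) := by gcongr; linarith
      _ = n * (2 * R * √A) * √A := by linear_combination (-(n * 2 * R)) * hss
  have h3 : Real.log (4 / δ) ≤ n * √A := by
    have : n * A ≤ n * √A := by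
      gcongr
      calc A = √A * √A := hss.symm
        _ ≤ √A * 1 := by gcongr
        _ = √A := mul_one _
    have hd : (0 : ℝ) ≤ d := Nat.cast_nonneg d
    linarith
  calc N * (4 * Real.exp (-(n * ((2 * R + 1) * √A))))
      ≤ Real.exp (d * (2 * R / √A)) * (4 * Real.exp (-(n * ((2 * R + 1) * √A)))) := by gcongr
    _ = 4 * Real.exp (d * (2 * R / √A) + -(n * ((2 * R + 1) * √A))) := by
        rw [Real.exp_add]; ring
    _ ≤ 4 * Real.exp (-Real.log (4 / δ)) := by
        gcongr
        linarith
    _ = δ := by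
        rw [Real.exp_neg, Real.exp_log (by positivity)]; field_simp

/-- With high probability the gradients of the empirical and the population primal function are
uniformly close. -/
theorem IsNCSC.measure_gradOn_primal_deviation_le (h : IsNCSC P X Y f μ β DX DY)
    (hLip : IsLip X Y f L) (hμ : 0 < μ) (hβ : 0 < β) (hL : 0 < L) {n : ℕ} (hn : 0 < n)
    {δ A : ℝ} (hδ : 0 < δ) (hδ1 : δ < 1) (hA : A = (d + Real.log (4 / δ)) / n) (hA1 : A ≤ 1) :
    (Measure.pi fun _ : Fin n => P)
      {S | ¬ ∀ x ∈ X, ‖gradOn X (primal Y (empRisk f S)) x -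
          gradOn X (primal Y (popRisk P f)) x‖ ^ 2 ≤
        (16 * (β / μ + 1) ^ 2 * L ^ 2 * (2 * √DX + 1) + 8 * β ^ 2 * (β / μ + 1) ^ 4) * √A} ≤
      ENNReal.ofReal δ := by
  have hn' : (0 : ℝ) < n := by exact_mod_cast hn
  have hlog : 0 < Real.log (4 / δ) := Real.log_pos (by rw [lt_div_iff₀ hδ]; linarith)
  have hA0 : 0 < A := by rw [hA]; positivity
  have hs : 0 < √A := Real.sqrt_pos.2 hA0
  have hAs : A ≤ √A := Real.le_sqrt_of_sq_le (by nlinarith)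
  set κ := β / μ with hκ
  have hκ0 : 0 < κ := by positivity
  have hpop := h.isSmoothSaddle_popRisk hLip hβ.le
  -- The maximizer is fixed before the sample is drawn, so concentration applies at each `(c, ys c)`
  -- with `c` in the net.
  obtain ⟨ys, hys⟩ := hpop.exists_isArgmax h.compact_Y h.nonempty_Y
  obtain ⟨N, hNX, hNcard, hNnet⟩ := exists_net_card_le (Real.sqrt_nonneg DX) hs X
    fun x hx => Real.le_sqrt_of_sq_le (h.bound_X x hx)
  rw [finrank_euclideanSpace_fin] at hNcard
  -- Chosen so that the Hoeffding exponent is `n (2√DX + 1) √A`, as the count over the net requires.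
  set τ : ℝ := √(8 * L ^ 2 * ((2 * √DX + 1) * √A)) with hτ
  have hτ0 : 0 < τ := Real.sqrt_pos.2 (by positivity)
  have hτ2 : τ ^ 2 = 8 * L ^ 2 * ((2 * √DX + 1) * √A) := Real.sq_sqrt (by positivity)
  let gx : Euc d → Euc d' → Z → Euc d := fun x y z => gradX X (fun x y => f x y z) x y
  let gy : Euc d → Euc d' → Z → Euc d' := fun x y z => gradY Y (fun x y => f x y z) x y
  let Bx : Euc d → Set (Fin n → Z) := fun c =>
    {S | τ ≤ ‖(1 / (n : ℝ)) • ∑ i, gx c (ys c) (S i) - ∫ z, gx c (ys c) z ∂P‖}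
  let By : Euc d → Set (Fin n → Z) := fun c =>
    {S | τ ≤ ‖(1 / (n : ℝ)) • ∑ i, gy c (ys c) (S i) - ∫ z, gy c (ys c) z ∂P‖}
  have hsub : {S | ¬ ∀ x ∈ X, ‖gradOn X (primal Y (empRisk f S)) x -
      gradOn X (primal Y (popRisk P f)) x‖ ^ 2 ≤
        (16 * (κ + 1) ^ 2 * L ^ 2 * (2 * √DX + 1) + 8 * β ^ 2 * (κ + 1) ^ 4) * √A} ⊆
      ⋃ c ∈ N, (Bx c ∪ By c) := by
    intro S hS
    by_contra hgood
    simp only [Set.mem_iUnion, Set.mem_union, not_exists, not_or] at hgood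
    refine hS fun x hx => ?_
    have hemp := h.isSmoothSaddle_empRisk hLip hβ.le hn S
    obtain ⟨ys', hys'⟩ := hemp.exists_isArgmax h.compact_Y h.nonempty_Y
    obtain ⟨c, hcN, hc⟩ := hNnet x hx
    have hcX := hNX c hcN
    obtain ⟨hgx, hgy⟩ := hgood c hcN
    have hgx' : ‖(1 / (n : ℝ)) • ∑ i, gx c (ys c) (S i) - ∫ z, gx c (ys c) z ∂P‖ < τ :=
      not_le.1 hgx
    have hgy' : ‖(1 / (n : ℝ)) • ∑ i, gy c (ys c) (S i) - ∫ z, gy c (ys c) z ∂P‖ < τ :=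
      not_le.1 hgy
    have mx := (hys x hx).1
    have mc := (hys c hcX).1
    have hyy : ‖x - c‖ + ‖ys x - ys c‖ ≤ (κ + 1) * √A := by
      have := hpop.norm_argmax_sub_le hμ h.convex_Y hys hx hcX
      have : κ * ‖x - c‖ ≤ κ * √A := by gcongr
      linarith
    have tri : ∀ {k : ℕ} (a b a' b' : Euc k) (r q : ℝ), ‖a - a'‖ ≤ r → ‖a' - b'‖ < q →
        ‖b - b'‖ ≤ r → ‖a - b‖ ≤ q + 2 * r := by
      intro k a b a' b' r q h1 h2 h3
      have e : a - b = (a - a') + (a' - b') - (b - b') := by abel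
      rw [e]
      have := norm_sub_le ((a - a') + (a' - b')) (b - b')
      have := norm_add_le (a - a') (a' - b')
      linarith
    have hβr : β * (‖x - c‖ + ‖ys x - ys c‖) ≤ β * ((κ + 1) * √A) := by gcongr
    have hDx := tri _ _ _ _ _ _ ((hemp.lip_x x hx c hcX _ mx _ mc).trans hβr) hgx'
      ((hpop.lip_x x hx c hcX _ mx _ mc).trans hβr)
    have hDy := tri _ _ _ _ _ _ ((hemp.lip_y x hx c hcX _ mx _ mc).trans hβr) hgy'
      ((hpop.lip_y x hx c hcX _ mx _ mc).trans hβr)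
    have hgap := hpop.norm_gradOn_primal_sub_le hμ hβ h.convex_X h.convex_Y hys hemp hys' hx
    rw [← hκ] at hgap
    have hD : ‖gradOn X (primal Y (empRisk f S)) x - gradOn X (primal Y (popRisk P f)) x‖ ≤
        (κ + 1) * (τ + 2 * (β * ((κ + 1) * √A))) := by
      have := mul_le_mul_of_nonneg_left hDy hκ0.le
      linarith
    calc _ ≤ ((κ + 1) * (τ + 2 * (β * ((κ + 1) * √A)))) ^ 2 := by gcongr
      _ = (κ + 1) ^ 2 * (τ + 2 * (β * ((κ + 1) * √A))) ^ 2 := by ring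
      _ ≤ (κ + 1) ^ 2 * (2 * (τ ^ 2 + (2 * (β * ((κ + 1) * √A))) ^ 2)) := by
        gcongr
        exact add_sq_le
      _ = 16 * (κ + 1) ^ 2 * L ^ 2 * (2 * √DX + 1) * √A +
          8 * β ^ 2 * (κ + 1) ^ 4 * A := by
        rw [hτ2]
        linear_combination (8 * β ^ 2 * (κ + 1) ^ 4) * Real.sq_sqrt hA0.le
      _ ≤ 16 * (κ + 1) ^ 2 * L ^ 2 * (2 * √DX + 1) * √A +
          8 * β ^ 2 * (κ + 1) ^ 4 * √A := by gcongr
      _ = _ := by ring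
  refine (measure_mono hsub).trans ((measure_biUnion_finset_le N _).trans ?_)
  have hexp : (n : ℝ) * τ ^ 2 / (8 * L ^ 2) = n * ((2 * √DX + 1) * √A) := by
    rw [hτ2]; field_simp
  have hone : ∀ c ∈ N, (Measure.pi fun _ : Fin n => P) (Bx c ∪ By c) ≤
      ENNReal.ofReal (4 * Real.exp (-(n * ((2 * √DX + 1) * √A)))) := by
    intro c hc
    have hcX := hNX c hc
    have mc := (hys c hcX).1
    have b1 := measure_le_norm_average_sub_integral_le (P := P) (h.measurable_gradX hcX mc) hL
      (fun z => (hLip z c hcX _ mc).1) hn hτ0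
    have b2 := measure_le_norm_average_sub_integral_le (P := P) (h.measurable_gradY hcX mc) hL
      (fun z => (hLip z c hcX _ mc).2) hn hτ0
    rw [hexp] at b1 b2
    refine (measure_union_le _ _).trans ((add_le_add b1 b2).trans (le_of_eq ?_))
    rw [← ENNReal.ofReal_add (by positivity) (by positivity)]
    congr 1
    ring
  refine (Finset.sum_le_sum hone).trans ?_
  rw [Finset.sum_const, nsmul_eq_mul, ← ENNReal.ofReal_natCast,
    ← ENNReal.ofReal_mul (Nat.cast_nonneg _)]
  exact ENNReal.ofReal_le_ofReal
    (four_mul_card_mul_exp_le (Real.sqrt_nonneg DX) hn hδ hA hA0 hA1 hlog.le hNcard)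

end Deviation

/-! ### Combination of the optimization and statistical errors. -/

/-- Convergence of gradient descent ascent in the population primal gradient, with the statistical
error at the rate `√((d + log (4/δ)) / n)`. -/
theorem exists_avgSqGrad_le (μ β L DX DY : ℝ) (hμ : 0 < μ) (hβ : 0 < β) (hL : 0 < L)
    (hDX : 0 < DX) (hDY : 0 < DY) :
    ∃ C : ℝ, 0 < C ∧
      ∀ (Z : Type*) [MeasurableSpace Z] (P : Measure Z) [IsProbabilityMeasure P]
        (d d' n T : ℕ) (X : Set (Euc d)) (Y : Set (Euc d')) (f : Euc d → Euc d' → Z → ℝ) (δ : ℝ),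
        IsNCSC P X Y f μ β DX DY → IsLip X Y f L → 0 < n → 0 < T → 0 < δ → δ < 1 →
        (Measure.pi fun _ : Fin n => P)
          {S | ¬ (GdaRuns X Y f μ β S T →
            avgSqGrad P X Y f μ β S T ≤
              C * (1 / T) + C * √((d + Real.log (4 / δ)) / n))} ≤ ENNReal.ofReal δ := by
  obtain ⟨η, hη⟩ : ∃ η, η = 1 / (16 * (β / μ + 1) ^ 2 * β) := ⟨_, rfl⟩
  obtain ⟨c, hc⟩ : ∃ c, c = η * β ^ 2 * (β / μ + 1) / 2 := ⟨_, rfl⟩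
  have hη0 : 0 < η := by rw [hη]; positivity
  have hc0 : 0 < c := by rw [hc]; positivity
  obtain ⟨K, hK⟩ : ∃ K, K = 16 * (β / μ + 1) ^ 2 * L ^ 2 * (2 * √DX + 1) +
    8 * β ^ 2 * (β / μ + 1) ^ 4 := ⟨_, rfl⟩
  obtain ⟨K', hK'⟩ : ∃ K', K' = 2 / η * (2 * L * √DX + 4 * (β * (β / μ + 1 / 2)) * DX +
    4 * c * DY) + L ^ 2 := ⟨_, rfl⟩
  have hK0 : 0 < K := by rw [hK]; positivity
  have hK0' : 0 < K' := by rw [hK']; positivity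
  refine ⟨2 * K + 2 * K' + L ^ 2, by positivity, ?_⟩
  intro Z _ P _ d d' n T X Y f δ h hLip hn hT hδ hδ1
  obtain ⟨A, hA⟩ : ∃ A : ℝ, A = (d + Real.log (4 / δ)) / n := ⟨_, rfl⟩
  rw [← hA]
  have hT' : (0 : ℝ) < T := by exact_mod_cast hT
  have hs := Real.sqrt_nonneg A
  have hpop := h.isSmoothSaddle_popRisk hLip hβ.le
  obtain ⟨ys, hys⟩ := hpop.exists_isArgmax h.compact_Y h.nonempty_Y
  have havg : ∀ (S : Fin n → Z) (B : ℝ), ∑ t ∈ Finset.range T,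
      ‖gradOn X (primal Y (popRisk P f)) (gdaSeq X Y f μ β S t).1‖ ^ 2 ≤ B →
      avgSqGrad P X Y f μ β S T ≤ B * (1 / T) := by
    intro S B hB
    rw [avgSqGrad, mul_comm]
    gcongr
  -- For `A > 1` the bound holds on every sample, because the primal gradient has norm at most `L`.
  rcases le_or_gt A 1 with hA1 | hA1
  · refine (measure_mono ?_).trans
      (h.measure_gradOn_primal_deviation_le hLip hμ hβ hL hn hδ hδ1 hA hA1)
    intro S hS hdev
    refine hS fun hruns => ?_
    have hemp := h.isSmoothSaddle_empRisk hLip hβ.le hn S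
    obtain ⟨ys', hys'⟩ := hemp.exists_isArgmax h.compact_Y h.nonempty_Y
    have hsum : ∑ t ∈ Finset.range T,
        ‖gradOn X (primal Y (empRisk f S)) (gdaSeq X Y f μ β S t).1‖ ^ 2 ≤ K' := by
      rw [hK', gdaSeq, ← hη]
      refine hemp.sum_norm_gradOn_primal_sq_le hμ hβ h.convex_X h.convex_Y hys' h.bound_X
        h.bound_Y hη hc hT ?_
      rw [GdaRuns, gdaSeq, ← hη] at hruns
      exact hruns
    rw [← hK] at hdev
    have hsum' : ∑ t ∈ Finset.range T,
        ‖gradOn X (primal Y (popRisk P f)) (gdaSeq X Y f μ β S t).1‖ ^ 2 ≤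
          2 * K' + T * (2 * (K * √A)) := by
      calc _ ≤ ∑ t ∈ Finset.range T,
            (2 * ‖gradOn X (primal Y (empRisk f S)) (gdaSeq X Y f μ β S t).1‖ ^ 2 +
              2 * (K * √A)) := by
            refine Finset.sum_le_sum fun t ht => ?_
            have h1 := hdev _ (hruns t (Finset.mem_range.1 ht)).1
            set a := gradOn X (primal Y (popRisk P f)) (gdaSeq X Y f μ β S t).1
            set b := gradOn X (primal Y (empRisk f S)) (gdaSeq X Y f μ β S t).1
            have h2 : ‖a‖ ≤ ‖b‖ + ‖b - a‖ := norm_le_norm_add_norm_sub b a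
            have h3 : ‖a‖ ^ 2 ≤ (‖b‖ + ‖b - a‖) ^ 2 := by gcongr
            have h4 : (‖b‖ + ‖b - a‖) ^ 2 ≤ 2 * (‖b‖ ^ 2 + ‖b - a‖ ^ 2) := add_sq_le
            linarith
        _ = 2 * ∑ t ∈ Finset.range T,
            ‖gradOn X (primal Y (empRisk f S)) (gdaSeq X Y f μ β S t).1‖ ^ 2 +
              T * (2 * (K * √A)) := by
            rw [Finset.sum_add_distrib, ← Finset.mul_sum]; simp
        _ ≤ _ := by gcongr
    refine (havg S _ hsum').trans ?_
    have e : (2 * K' + T * (2 * (K * √A))) * (1 / (T : ℝ)) =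
        2 * K' * (1 / T) + 2 * K * √A := by field_simp
    rw [e]
    gcongr
    · nlinarith [sq_nonneg L]
    · nlinarith [sq_nonneg L]
  · refine (measure_mono (t := ∅) fun S hS => ?_).trans (measure_empty.trans_le zero_le)
    refine hS fun hruns => ?_
    have hsum : ∑ t ∈ Finset.range T,
        ‖gradOn X (primal Y (popRisk P f)) (gdaSeq X Y f μ β S t).1‖ ^ 2 ≤ T * L ^ 2 := by
      calc _ ≤ ∑ t ∈ Finset.range T, L ^ 2 := by
            refine Finset.sum_le_sum fun t ht => ?_
            have hx := (hruns t (Finset.mem_range.1 ht)).1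
            rw [hpop.gradOn_primal hμ hβ h.convex_X h.convex_Y hys hx]
            exact pow_le_pow_left₀ (norm_nonneg _) (hpop.bound_x _ hx _ (hys _ hx).1) 2
        _ = _ := by simp
    refine (havg S _ hsum).trans ?_
    have e : T * L ^ 2 * (1 / (T : ℝ)) = L ^ 2 * 1 := by field_simp
    rw [e]
    have h1 : 1 ≤ √A := Real.one_le_sqrt.2 hA1.le
    have h2 : 0 ≤ (2 * K + 2 * K' + L ^ 2) * (1 / (T : ℝ)) := by positivity
    have h3 : L ^ 2 * 1 ≤ (2 * K + 2 * K' + L ^ 2) * √A := by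
      gcongr
      linarith
    linarith

theorem two_mul_sqrt_le_one_div_add_mul {a T : ℝ} (ha : 0 ≤ a) (hT : 0 < T) :
    2 * √a ≤ 1 / T + a * T := by
  have h1 : 1 / T + a * T - 2 * √a = (√a * T - 1) ^ 2 / T := by
    field_simp
    linear_combination (-T ^ 2) * Real.sq_sqrt ha
  have : 0 ≤ (√a * T - 1) ^ 2 / T := by positivity
  linarith

/-- Already `log 2 ≥ 2/3`, and `log u ≥ 1 - 1/u` at `u = 2/3`. For small `n` the term `log log n` is
negative; this bound lets half of `d ≥ 1` absorb it. -/
theorem neg_half_le_log_log {n : ℕ} (hn : 2 ≤ n) : -(1 / 2) ≤ Real.log (Real.log n) := by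
  have h2 : Real.log 2 ≤ Real.log n := Real.log_le_log two_pos (by exact_mod_cast hn)
  have h3 : (2 / 3 : ℝ) ≤ Real.log n := by linarith [Real.log_two_gt_d9]
  have h4 := Real.one_sub_inv_le_log_of_pos (by norm_num : (0 : ℝ) < 2 / 3)
  have h5 := Real.log_le_log (by norm_num) h3
  norm_num at h4
  linarith

theorem log_four_le_two : Real.log 4 ≤ 2 := by
  have : (4 : ℝ) = 2 ^ 2 := by norm_num
  rw [this, Real.log_pow]
  push_cast
  linarith [Real.log_two_lt_d9]

theorem theorem5 (μ β L DX DY : ℝ) (hμ : 0 < μ) (hβ : 0 < β) (hL : 0 < L)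
    (hDX : 0 < DX) (hDY : 0 < DY) :
    (∃ C : ℝ, 0 < C ∧
      ∀ (Z : Type*) [MeasurableSpace Z] (P : Measure Z) [IsProbabilityMeasure P]
        (d d' n T : ℕ) (X : Set (Euc d)) (Y : Set (Euc d')) (f : Euc d → Euc d' → Z → ℝ)
        (xs : Euc d) (R₁ δ : ℝ),
        IsNCSC P X Y f μ β DX DY → IsLip X Y f L →
        xs ∈ X → IsMinOn (primal Y (popRisk P f)) X xs → X ⊆ Metric.closedBall xs R₁ →
        0 < n → 1 ≤ √2 * R₁ * n → 0 < T → 0 < δ → δ < 1 →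
        (Measure.pi fun _ : Fin n => P)
          {S | ¬ (GdaRuns X Y f μ β S T →
            avgSqGrad P X Y f μ β S T ≤
              C * (1 / T) +
                C * ((d + Real.log (16 * Real.logb 2 (√2 * R₁ * n + 1) / δ)) / n * T))} ≤
          ENNReal.ofReal δ) ∧
    (∀ c₁ c₂ : ℝ, 0 < c₁ → 0 < c₂ → ∃ C : ℝ, 0 < C ∧
      ∀ (Z : Type*) [MeasurableSpace Z] (P : Measure Z) [IsProbabilityMeasure P]
        (d d' n T : ℕ) (X : Set (Euc d)) (Y : Set (Euc d')) (f : Euc d → Euc d' → Z → ℝ)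
        (δ : ℝ),
        IsNCSC P X Y f μ β DX DY → IsLip X Y f L →
        0 < d → 2 ≤ n → 0 < T → c₁ * √((n : ℝ) / d) ≤ T → T ≤ c₂ * √((n : ℝ) / d) →
        0 < δ → δ < 1 →
        (Measure.pi fun _ : Fin n => P)
          {S | ¬ (GdaRuns X Y f μ β S T →
            avgSqGrad P X Y f μ β S T ≤
              C * ((d + Real.log (Real.log n / δ)) / √((n : ℝ) * d)))} ≤
          ENNReal.ofReal δ) := by
  refine ⟨?_, fun c₁ c₂ hc₁ hc₂ => ?_⟩
  · obtain ⟨C, hC, hmain⟩ := exists_avgSqGrad_le μ β L DX DY hμ hβ hL hDX hDY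
    refine ⟨2 * C, by positivity, ?_⟩
    intro Z _ P _ d d' n T X Y f xs R₁ δ h hLip _ _ _ hn hR hT hδ hδ1
    refine (measure_mono ?_).trans (hmain Z P d d' n T X Y f δ h hLip hn hT hδ hδ1)
    refine fun S hS hgood => hS fun hruns => (hgood hruns).trans ?_
    have hT' : (0 : ℝ) < T := by exact_mod_cast hT
    have hn' : (0 : ℝ) < n := by exact_mod_cast hn
    have hlog : 0 ≤ Real.log (4 / δ) := Real.log_nonneg (by rw [le_div_iff₀ hδ]; linarith)
    -- The argument is at least `2`, so the logarithmic term of the claim dominates `log(4/δ)`.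
    have hlogb : 1 ≤ Real.logb 2 (√2 * R₁ * n + 1) := by
      rw [Real.le_logb_iff_rpow_le one_lt_two (by linarith), Real.rpow_one]
      linarith
    have hle : (d + Real.log (4 / δ)) / n ≤
        (d + Real.log (16 * Real.logb 2 (√2 * R₁ * n + 1) / δ)) / n := by
      gcongr
      linarith
    have h1 := two_mul_sqrt_le_one_div_add_mul
      (by positivity : 0 ≤ (d + Real.log (4 / δ)) / n) hT'
    have h2 := mul_le_mul_of_nonneg_right hle hT'.le
    have h3 : √((d + Real.log (4 / δ)) / n) ≤ 1 / T +
        2 * ((d + Real.log (16 * Real.logb 2 (√2 * R₁ * n + 1) / δ)) / n * T) := by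
      have : 0 ≤ (d + Real.log (4 / δ)) / n * T := by positivity
      have : (0 : ℝ) ≤ 1 / T := by positivity
      linarith
    have h4 := mul_le_mul_of_nonneg_left h3 hC.le
    linarith
  · obtain ⟨C, hC, hmain⟩ := exists_avgSqGrad_le μ β L DX DY hμ hβ hL hDX hDY
    refine ⟨C * (4 / c₁ + 6 * c₂), by positivity, ?_⟩
    intro Z _ P _ d d' n T X Y f δ h hLip hd hn hT hT1 hT2 hδ hδ1
    refine (measure_mono ?_).trans (hmain Z P d d' n T X Y f δ h hLip (by omega) hT hδ hδ1)
    refine fun S hS hgood => hS fun hruns => (hgood hruns).trans ?_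
    have hT' : (0 : ℝ) < T := by exact_mod_cast hT
    have hn' : (0 : ℝ) < n := by exact_mod_cast (by omega : 0 < n)
    have hd' : (1 : ℝ) ≤ d := by exact_mod_cast hd
    have hd0 : (0 : ℝ) < d := by linarith
    have hlog : 0 ≤ Real.log (4 / δ) := Real.log_nonneg (by rw [le_div_iff₀ hδ]; linarith)
    have hlogn : 0 < Real.log n := Real.log_pos (by exact_mod_cast (by omega : 1 < n))
    have hlogδ : Real.log δ ≤ 0 := Real.log_nonpos hδ.le hδ1.le
    set B := d + Real.log (Real.log n / δ) with hB
    have hBlow : d / 2 - Real.log δ ≤ B := by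
      rw [hB, Real.log_div hlogn.ne' hδ.ne']
      linarith [neg_half_le_log_log hn]
    -- From `log 4 ≤ 2 ≤ 2d`, the left side is at most `3d - log δ`, and `B ≥ d/2 - log δ`.
    have h4B : d + Real.log (4 / δ) ≤ 6 * B := by
      rw [Real.log_div (by norm_num) hδ.ne']
      linarith [log_four_le_two]
    have hdB : d ≤ 2 * B := by linarith
    set s := √((n : ℝ) * d) with hs
    have hs0 : 0 < s := Real.sqrt_pos.2 (by positivity)
    have hss : s ^ 2 = n * d := Real.sq_sqrt (by positivity)
    -- The range of `T` in terms of `s = √(n d)` makes both `1/T` and `A T` of order `B / s`.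
    have hsd : √((n : ℝ) / d) = s / d := by
      rw [hs, ← Real.sqrt_sq hd0.le, ← Real.sqrt_div (by positivity), Real.sqrt_sq hd0.le]
      congr 1
      field_simp
    rw [hsd] at hT1 hT2
    have h1 : 1 / (T : ℝ) ≤ 2 / c₁ * (B / s) := by
      calc 1 / (T : ℝ) ≤ 1 / (c₁ * (s / d)) := by gcongr
        _ = d / (c₁ * s) := by field_simp
        _ ≤ 2 * B / (c₁ * s) := by gcongr
        _ = _ := by field_simp
    have h2 : (d + Real.log (4 / δ)) / n * T ≤ 6 * c₂ * (B / s) := by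
      calc (d + Real.log (4 / δ)) / n * T ≤ 6 * B / n * (c₂ * (s / d)) := by
            gcongr
            exact div_nonneg (by linarith) hn'.le
        _ = 6 * c₂ * B * s / (n * d) := by field_simp
        _ = _ := by rw [← hss]; field_simp
    have h3 := two_mul_sqrt_le_one_div_add_mul
      (by positivity : 0 ≤ (d + Real.log (4 / δ)) / n) hT'
    have hBs : 0 ≤ B / s := div_nonneg (by linarith) hs0.le
    have h4 : 1 / (T : ℝ) + √((d + Real.log (4 / δ)) / n) ≤ (4 / c₁ + 6 * c₂) * (B / s) := by
      have e : (4 / c₁ + 6 * c₂) * (B / s) = 2 * (2 / c₁ * (B / s)) + 6 * c₂ * (B / s) := by ring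
      have : 0 ≤ (d + Real.log (4 / δ)) / n * T := by positivity
      rw [e]
      linarith [Real.sqrt_nonneg ((d + Real.log (4 / δ)) / (n : ℝ))]
    have h5 := mul_le_mul_of_nonneg_left h4 hC.le
    linarith
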